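/- Let $\Gamma$ be a Fuchsian group (a group of orientation-preserving isometries of the hyperbolic plane $\mathbb H^2$ none of whose orbits has an accumulation point in $\mathbb H^2$). Let $P$ be a compact convex geodesic polygon with $N\ge 3$ vertices $v_i$ and sides $s_i=[v_i,v_{i+1}]$, $i\in\mathbb Z/N$ (interior angles equal to $\pi$ are allowed), that is a fundamental polygon of $\Gamma$ with paired sides: the images $\gamma P$, $\gamma\in\Gamma$, cover $\mathbb H^2$; the interiors of $P$ and $\gamma P$ are disjoint unless $\gamma=1$; and every side $s_i$ is the image $\gamma s_j$ of a side under some $\gamma\in\Gamma$ with $\gamma P\ne P$. Let $T\subseteq\Gamma$ be the set of all $\gamma$ such that $\gamma P=P$ or $\gamma P$ has a common edge or a common vertex with $P$. For $n\ge 0$ let $T^n(P)=\bigcup_{\gamma\in T^n}\gamma P$ (so $T^0(P)=P$). Write $\delta$ for the hyperbolic distance, $\delta(A,B)=\inf_{a\in A,\,b\in B}\delta(a,b)$ for sets, and $\partial$ for the topological boundary. The shell-crossing distance is $$\mathscr T=\min_{n\ge 0}\ \delta\bigl(\partial T^n(P),\,\partial T^{n+1}(P)\bigr).$$ Then this minimum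 exists and is attained at $n=0$, $$\mathscr T=\delta\bigl(\partial P,\ \partial T(P)\bigr),$$ so that every crossing distance satisfies $\delta(\partial T^n(P),\partial T^{n+1}(P))\ge\delta(\partial P,\partial T(P))$; and $$\mathscr T\ \ge\ \min\bigl(\{\delta_{ij} : s_i,s_j\text{ distinct and non-adjacent}\}\cup\{2\varepsilon_k : k\in\mathbb Z/N\}\bigr),$$ where $\delta_{ij}=\delta(s_i,s_j)$, sides are adjacent when their indices differ by $\pm1$ modulo $N$, and $\varepsilon_k$ is the distance from the midpoint of $s_k$ to $s_{k-1}\cup s_{k+1}$. -/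

import Mathlib

open UpperHalfPlane Filter Topology
open scoped Pointwise MatrixGroups

noncomputable section

namespace HypTess

/-- The closed geodesic segment joining two points of the hyperbolic plane
(the upper half-plane model, with its hyperbolic distance `dist`). -/
def geodSegment (z w : ℍ) : Set ℍ := {x | dist z x + dist x w = dist z w}

/-- The distance `δ(A, B)` between two sets: the infimum of the distances between their points. -/
def setDist (A B : Set ℍ) : ℝ := sInf {d | ∃ x ∈ A, ∃ y ∈ B, d = dist x y}

/-- A group of orientation-preserving isometries of the hyperbolic plane is Fuchsian when no orbit
has an accumulation point in the plane.  It is represented by a group of matrices, so the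
non-identity matrix `-1` may act trivially. -/
def IsFuchsian (Γ : Subgroup SL(2, ℝ)) : Prop :=
  ∀ z w : ℍ, ¬ AccPt w (𝓟 (MulAction.orbit Γ z))

/-- The side number `i` of the polygon with vertices `v 0, …, v (N - 1)` in cyclic order. -/
def side {N : ℕ} (v : ZMod N → ℍ) (i : ZMod N) : Set ℍ := geodSegment (v i) (v (i + 1))

/-- Two sides of a polygon are adjacent when their numbers differ by one (modulo `N`). -/
def Adjacent {N : ℕ} (i j : ZMod N) : Prop := j = i + 1 ∨ j = i - 1

/-- `P` is the compact convex hyperbolic polygon bounded by the simple closed geodesic polygonal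
curve with the vertices `v i` in cyclic order (interior angles equal to `π` are allowed). -/
structure IsConvexPolygon {N : ℕ} (P : Set ℍ) (v : ZMod N → ℍ) : Prop where
  three_le : 3 ≤ N
  isCompact : IsCompact P
  interior_nonempty : (interior P).Nonempty
  convex : ∀ x ∈ P, ∀ y ∈ P, geodSegment x y ⊆ P
  frontier_eq : frontier P = ⋃ i, side v i
  vertex_injective : Function.Injective v
  side_inter_next : ∀ i, side v i ∩ side v (i + 1) = {v (i + 1)}
  side_disjoint : ∀ i j, i ≠ j → ¬ Adjacent i j → Disjoint (side v i) (side v j)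

/-- `P` is a fundamental polygon of `Γ` whose sides are paired by `Γ`. -/
structure IsFundamentalPolygon {N : ℕ} (Γ : Subgroup SL(2, ℝ)) (P : Set ℍ) (v : ZMod N → ℍ) :
    Prop where
  polygon : IsConvexPolygon P v
  covers : ∀ z : ℍ, ∃ γ ∈ Γ, z ∈ γ • P
  interiors_disjoint : ∀ γ ∈ Γ, (interior P ∩ γ • interior P).Nonempty → ∀ z : ℍ, γ • z = z
  side_pairing : ∀ i, ∃ γ ∈ Γ, ∃ j, γ • side v j = side v i ∧ γ • P ≠ P

/-- The set `T ⊆ Γ` of the elements that map `P` to itself or to a neighbour of `P`, that is, to an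
image of `P` that has an edge or a vertex in common with `P`. -/
def neighborSet {N : ℕ} (Γ : Subgroup SL(2, ℝ)) (P : Set ℍ) (v : ZMod N → ℍ) : Set SL(2, ℝ) :=
  {γ | γ ∈ Γ ∧ (γ • P = P ∨ (∃ i j, γ • side v j = side v i) ∨ ∃ i j, γ • v j = v i)}

/-- `T ^ n (P)`, the union of the images `γ P` over all products `γ` of `n` elements of `T`. -/
def shellRegion {N : ℕ} (Γ : Subgroup SL(2, ℝ)) (P : Set ℍ) (v : ZMod N → ℍ) (n : ℕ) : Set ℍ :=
  ⋃ γ ∈ neighborSet Γ P v ^ n, γ • P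

/-- The distances `δ(∂ T ^ n (P), ∂ T ^ (n + 1) (P))`. -/
def crossingDist {N : ℕ} (Γ : Subgroup SL(2, ℝ)) (P : Set ℍ) (v : ZMod N → ℍ) (n : ℕ) : ℝ :=
  setDist (frontier (shellRegion Γ P v n)) (frontier (shellRegion Γ P v (n + 1)))

/-- The shell-crossing distance, the infimum of all `crossingDist`. -/
def shellCrossingDist {N : ℕ} (Γ : Subgroup SL(2, ℝ)) (P : Set ℍ) (v : ZMod N → ℍ) : ℝ :=
  sInf (Set.range (crossingDist Γ P v))

/-- The one-point set that consists of the midpoint of the side number `k`. -/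
def sideMidpoint {N : ℕ} (v : ZMod N → ℍ) (k : ZMod N) : Set ℍ :=
  {m | dist (v k) m = dist (v k) (v (k + 1)) / 2 ∧ dist m (v (k + 1)) = dist (v k) (v (k + 1)) / 2}

/-- `ε_k`: the distance from the midpoint of the side number `k` to the two adjacent sides. -/
def epsilon {N : ℕ} (v : ZMod N → ℍ) (k : ZMod N) : ℝ :=
  setDist (sideMidpoint v k) (side v (k - 1) ∪ side v (k + 1))

/-- `δ_ij`: the distance between the sides `i` and `j`. -/
def delta {N : ℕ} (v : ZMod N → ℍ) (i j : ZMod N) : ℝ := setDist (side v i) (side v j)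

end HypTess

end

/-!
Write `T` for the set of neighbours of `P`, and `m` for the minimum of the numbers `δ_ij` and
`2 ε_k`.

**The minimum is attained at the first shell.** Let `x` be a boundary point of `T ^ n (P)`, in the
tile `γ P` with `γ ∈ T ^ n`, and `y` a boundary point of `T ^ (n + 1) (P)`. As
`γ T (P) ⊆ T ^ (n + 1) (P)`, the point `y` is not interior to `γ T (P)`, so the segment from `x` to
`y` meets the boundaries of both `γ P` and `γ T (P)`; translating by `γ⁻¹` gives
`crossingDist_zero_le`. Local finiteness of the tiling makes the shell regions closed and bounded,
so none of the boundaries is empty.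

**The lower bound.** A boundary point of `T (P)` lies in a tile that has no vertex in common with
`P`, so it is enough that a segment shorter than `m` only joins tiles with a common vertex
(`EdgeTiling.exists_common_vertex`). The side pairing makes the tiling edge-to-edge: near a
point of a side that is not a vertex there are exactly two tiles, and both have the whole
side (`EdgeTiling.exists_other_tile`). A vertex is at distance at least `m` from the opposite sides
of its tiles, so a short segment through a vertex stays in its star
(`EdgeTiling.isVertex_of_dist_lt`). A short segment without vertices that starts inside a tile
crosses each tile from one side to an adjacent one, since non-adjacent sides are at least `m` apart.
Among the vertices of the first tile take the one, `V`, whose star the segment leaves last. Just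
before it leaves, the segment crosses a side `f = [V, V']` and then cuts the corner at `V'` of the
tile after `f`. If it has also cut the corner at `V` of the tile before `f`, it is too long; if it
starts in one of these two tiles, it leaves the star of `V'` later than that of `V`, a
contradiction.

**Two corners** (`le_dist_add_dist_of_corners`). Let `M` be the midpoint of `f = [p, q]`, and let
the segment run from `a ∈ [p, r]` through `z ∈ f` to `b ∈ [q, t]`. The half-turn at `M` maps
`[p, r]` to a segment `[q, r']` on the same side of `f` as `[q, t]`. If `[q, r']` makes the larger
angle with `f`, then the image of `[a, z]`, which starts at the image `w` of `z`, either crosses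
`[q, t]` at a point `y`, and then `d(a, z) + d(z, b) ≥ d(w, y) + d(z, b) ≥ 2 d(M, [q, t])` because
`M` is the midpoint of `w` and `z` and distances between geodesics are convex; or it passes behind
`t`, and then `d(a, z) ≥ d(t, f)`, which is at least the double distance of the midpoint of
`[q, t]` from `f`. The other case is symmetric.

All incidence arguments take place in the chart `klein`, in which geodesics are straight lines; it
is the projectivized hyperboloid model, in which `cosh` of the distance is a bilinear form.
-/

namespace HypTess

/-! ### The projective chart, segments and midpoints -/

/-- The projective chart of the hyperbolic plane: it maps `ℍ` homeomorphically onto the region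
above the parabola `u₂ = u₁ ^ 2`, and hyperbolic geodesics to straight lines. -/
def klein (z : ℍ) : ℝ × ℝ := (z.re, z.re ^ 2 + z.im ^ 2)

/-- The range of the chart `klein`. -/
def kleinDomain : Set (ℝ × ℝ) := {u | u.1 ^ 2 < u.2}

/-- The inverse of the chart `klein`; its values off `kleinDomain` are irrelevant. -/
noncomputable def kleinInv (u : ℝ × ℝ) : ℍ := ofComplex ⟨u.1, √(u.2 - u.1 ^ 2)⟩

lemma klein_mem (z : ℍ) : klein z ∈ kleinDomain := by
  have := z.im_pos
  simp only [klein, kleinDomain, Set.mem_ofPred_eq]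
  nlinarith [pow_pos this 2]

lemma klein_kleinInv {u : ℝ × ℝ} (hu : u ∈ kleinDomain) : klein (kleinInv u) = u := by
  have h : 0 < u.2 - u.1 ^ 2 := sub_pos.2 hu
  have h' : 0 < (⟨u.1, √(u.2 - u.1 ^ 2)⟩ : ℂ).im := Real.sqrt_pos.2 h
  have e : kleinInv u = ⟨_, h'⟩ := ofComplex_apply_of_im_pos h'
  rw [e]
  ext
  · rfl
  · change u.1 ^ 2 + √(u.2 - u.1 ^ 2) ^ 2 = u.2
    rw [Real.sq_sqrt h.le]; ring

lemma klein_injective : Function.Injective klein := by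
  intro z w h
  have h1 : z.re = w.re := congrArg Prod.fst h
  have h2 : z.re ^ 2 + z.im ^ 2 = w.re ^ 2 + w.im ^ 2 := congrArg Prod.snd h
  rw [h1] at h2
  have h3 : z.im = w.im := by
    have := (pow_left_inj₀ z.im_pos.le w.im_pos.le two_ne_zero).1 (add_left_cancel h2)
    exact this
  exact UpperHalfPlane.ext (Complex.ext h1 h3)

lemma kleinInv_klein (z : ℍ) : kleinInv (klein z) = z :=
  klein_injective (klein_kleinInv (klein_mem z))

lemma continuous_klein : Continuous klein := by
  unfold klein
  have := UpperHalfPlane.continuous_re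
  have := UpperHalfPlane.continuous_im
  fun_prop

lemma isOpen_kleinDomain : IsOpen kleinDomain :=
  isOpen_lt (by fun_prop) (by fun_prop)

lemma continuousOn_kleinInv : ContinuousOn kleinInv kleinDomain := by
  have h : ContinuousOn (fun u : ℝ × ℝ => (⟨u.1, √(u.2 - u.1 ^ 2)⟩ : ℂ)) kleinDomain := by
    have : Continuous (fun u : ℝ × ℝ => Complex.equivRealProdCLM.symm (u.1, √(u.2 - u.1 ^ 2))) := by
      fun_prop
    refine (this.congr fun u => ?_).continuousOn
    simp [Complex.ext_iff]
  refine ofComplex.continuousOn.comp h fun u hu => ?_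
  have : 0 < √(u.2 - u.1 ^ 2) := Real.sqrt_pos.2 (sub_pos.2 hu)
  change _ ∈ ((↑) : ℍ → ℂ) '' Set.univ
  exact ⟨(⟨⟨u.1, √(u.2 - u.1 ^ 2)⟩, this⟩ : ℍ), trivial, rfl⟩

lemma isOpenMap_klein : IsOpenMap klein := by
  intro U hU
  have : klein '' U = kleinDomain ∩ kleinInv ⁻¹' U := by
    ext u
    constructor
    · rintro ⟨z, hz, rfl⟩
      exact ⟨klein_mem z, by simpa [kleinInv_klein] using hz⟩
    · rintro ⟨h1, h2⟩
      exact ⟨_, h2, klein_kleinInv h1⟩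
  rw [this]
  exact continuousOn_kleinInv.isOpen_inter_preimage isOpen_kleinDomain hU

lemma convex_kleinDomain : Convex ℝ kleinDomain := by
  intro u hu w hw a b ha hb hab
  simp only [kleinDomain, Set.mem_ofPred_eq, Prod.fst_add, Prod.smul_fst, smul_eq_mul, Prod.snd_add,
    Prod.smul_snd] at *
  have hb' : b = 1 - a := by linarith
  subst hb'
  rcases ha.eq_or_lt with rfl | ha
  · nlinarith
  · nlinarith [mul_nonneg (mul_nonneg ha.le hb) (sq_nonneg (u.1 - w.1)),
      mul_lt_mul_of_pos_left hu ha, mul_le_mul_of_nonneg_left hw.le hb]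

lemma segment_subset_kleinDomain (z w : ℍ) : segment ℝ (klein z) (klein w) ⊆ kleinDomain :=
  convex_kleinDomain.segment_subset (klein_mem z) (klein_mem w)

/-- In the hyperboloid model, a point on the line through `z` and `w` is a linear combination of
them, and `cosh` of the distance is the (bilinear) Lorentz form. -/
lemma cosh_dist_combo {x z w : ℍ} {a b : ℝ} (hab : a + b = 1)
    (h : klein x = a • klein z + b • klein w) (c : ℍ) :
    Real.cosh (dist x c) = a * z.im / x.im * Real.cosh (dist z c)
      + b * w.im / x.im * Real.cosh (dist w c) := by
  have h1 : x.re = a * z.re + b * w.re := by simpa [klein] using congrArg Prod.fst h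
  have h2 : x.re ^ 2 + x.im ^ 2 = a * (z.re ^ 2 + z.im ^ 2) + b * (w.re ^ 2 + w.im ^ 2) := by
    simpa [klein] using congrArg Prod.snd h
  have := x.im_ne_zero
  have := z.im_ne_zero
  have := w.im_ne_zero
  have := c.im_ne_zero
  simp only [cosh_dist']
  field_simp
  have e : (x.re - c.re) ^ 2 + x.im ^ 2 + c.im ^ 2
    = (x.re ^ 2 + x.im ^ 2) - 2 * x.re * c.re + (c.re ^ 2 + c.im ^ 2) * (a + b) := by
    rw [hab]; ring
  rw [e, h2, h1]
  ring

lemma dist_add_and_sinh_of_klein {x z w : ℍ} {a b : ℝ} (ha : 0 ≤ a) (hb : 0 ≤ b) (hab : a + b = 1)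
    (h : klein x = a • klein z + b • klein w) :
    dist z x + dist x w = dist z w ∧
    Real.sinh (dist z x) = b * w.im / x.im * Real.sinh (dist z w) ∧
    Real.sinh (dist x w) = a * z.im / x.im * Real.sinh (dist z w) := by
  set α := a * z.im / x.im
  set β := b * w.im / x.im
  have hα : 0 ≤ α := div_nonneg (mul_nonneg ha z.im_pos.le) x.im_pos.le
  have hβ : 0 ≤ β := div_nonneg (mul_nonneg hb w.im_pos.le) x.im_pos.le
  have hz := cosh_dist_combo hab h z
  have hw := cosh_dist_combo hab h w
  have hx := cosh_dist_combo hab h x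
  change _ = α * _ + β * _ at hz hw hx
  rw [dist_self, Real.cosh_zero, dist_comm z x, dist_comm w x] at hx
  rw [dist_self, Real.cosh_zero, dist_comm w z] at hz
  rw [dist_self, Real.cosh_zero] at hw
  set C := Real.cosh (dist z w)
  have hS := Real.cosh_sq (dist z w)
  have hS0 : 0 ≤ Real.sinh (dist z w) := Real.sinh_nonneg_iff.2 dist_nonneg
  change C ^ 2 = _ at hS
  set S := Real.sinh (dist z w)
  have key : α ^ 2 + β ^ 2 + 2 * α * β * C = 1 := by rw [hx, hz, hw]; ring
  have s1 : Real.sinh (dist x z) = β * S := by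
    refine (pow_left_inj₀ (Real.sinh_nonneg_iff.2 dist_nonneg) (mul_nonneg hβ hS0) two_ne_zero).1 ?_
    rw [Real.sinh_sq, hz]
    linear_combination β ^ 2 * hS + key
  have s2 : Real.sinh (dist x w) = α * S := by
    refine (pow_left_inj₀ (Real.sinh_nonneg_iff.2 dist_nonneg) (mul_nonneg hα hS0) two_ne_zero).1 ?_
    rw [Real.sinh_sq, hw]
    linear_combination α ^ 2 * hS + key
  refine ⟨?_, by rw [dist_comm, s1], s2⟩
  have hc : Real.cosh (dist x z + dist x w) = C := by
    rw [Real.cosh_add, hz, hw, s1, s2]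
    linear_combination C * key - α * β * hS
  have := Real.cosh_strictMonoOn.injOn (Set.mem_Ici.2 (add_nonneg dist_nonneg dist_nonneg))
    (Set.mem_Ici.2 dist_nonneg) hc
  rw [dist_comm z x, this]

lemma dist_add_of_klein {x z w : ℍ} (h : klein x ∈ segment ℝ (klein z) (klein w)) :
    dist z x + dist x w = dist z w := by
  obtain ⟨a, b, ha, hb, hab, h⟩ := h
  exact (dist_add_and_sinh_of_klein ha hb hab h.symm).1

/-- The intermediate value theorem along a geodesic. -/
lemma exists_klein_dist_eq (z w : ℍ) {r : ℝ} (h0 : 0 ≤ r) (h1 : r ≤ dist z w) :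
    ∃ x, klein x ∈ segment ℝ (klein z) (klein w) ∧ dist z x = r := by
  have hc : ContinuousOn (fun u => dist z (kleinInv u)) (segment ℝ (klein z) (klein w)) :=
    (continuous_const.dist continuous_id).comp_continuousOn
      (continuousOn_kleinInv.mono (segment_subset_kleinDomain z w))
  have hp : IsPreconnected (segment ℝ (klein z) (klein w)) := (convex_segment _ _).isPreconnected
  obtain ⟨u, hu, hur⟩ := hp.intermediate_value (left_mem_segment ℝ _ _) (right_mem_segment ℝ _ _) hc
    (show r ∈ Set.Icc _ _ by simpa [kleinInv_klein] using ⟨h0, h1⟩)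
  exact ⟨kleinInv u, by rwa [klein_kleinInv (segment_subset_kleinDomain z w hu)], hur⟩

/-- Half-angle form of the median formula at a midpoint lying on the straight segment. -/
lemma cosh_dist_of_klein_midpoint {m a b : ℍ} (h : klein m ∈ segment ℝ (klein a) (klein b))
    (hm : dist a m = dist m b) (c : ℍ) :
    2 * Real.cosh (dist a b / 2) * Real.cosh (dist m c)
      = Real.cosh (dist a c) + Real.cosh (dist b c) := by
  obtain ⟨s, t, hs, ht, hst, h⟩ := h
  obtain ⟨h1, h2, h3⟩ := dist_add_and_sinh_of_klein hs ht hst h.symm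
  by_cases hab : a = b
  · subst hab
    have : a = m := by
      rw [dist_self, dist_comm m a] at h1
      exact dist_eq_zero.1 (by linarith [dist_nonneg (x := a) (y := m)])
    subst this
    simp; ring
  have hS : 0 < Real.sinh (dist a b) := Real.sinh_pos_iff.2 (dist_pos.2 hab)
  have hd : dist a m = dist a b / 2 := by linarith
  rw [← hm, h2] at h3
  have hαβ := mul_right_cancel₀ hS.ne' h3
  have hc := cosh_dist_combo hst h.symm c
  rw [← hαβ, ← mul_add] at hc
  have h5 : Real.sinh (dist a b) = 2 * Real.sinh (dist a b / 2) * Real.cosh (dist a b / 2) := by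
    rw [← Real.sinh_two_mul]; ring_nf
  rw [hd, h5] at h2
  have h6 : 0 < Real.sinh (dist a b / 2) := Real.sinh_pos_iff.2 (half_pos (dist_pos.2 hab))
  have h7 : 2 * Real.cosh (dist a b / 2) * (t * b.im / m.im) = 1 := by
    have : Real.sinh (dist a b / 2) * (2 * Real.cosh (dist a b / 2) * (t * b.im / m.im))
      = Real.sinh (dist a b / 2) * 1 := by linear_combination -h2
    exact mul_left_cancel₀ h6.ne' this
  rw [hc, ← mul_assoc, h7, one_mul]

/-- Hyperbolic segments are the straight segments of the chart. -/
lemma mem_geodSegment_iff {x z w : ℍ} :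
    x ∈ geodSegment z w ↔ klein x ∈ segment ℝ (klein z) (klein w) := by
  refine ⟨fun hx => ?_, dist_add_of_klein⟩
  have hx' : dist z x + dist x w = dist z w := hx
  obtain ⟨y, hy, hyd⟩ := exists_klein_dist_eq z w (r := dist z x) dist_nonneg
    (by linarith [dist_nonneg (x := x) (y := w)])
  have hy' := dist_add_of_klein hy
  suffices x = y by rwa [this]
  by_contra hne
  -- The midpoint of two different candidates would be strictly closer to both ends.
  obtain ⟨m, hm, hmd⟩ := exists_klein_dist_eq x y (r := dist x y / 2) (by positivity)
    (by linarith [dist_nonneg (x := x) (y := y)])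
  have hm' := dist_add_of_klein hm
  have hm1 := fun c => cosh_dist_of_klein_midpoint hm (by linarith) c
  have hlt : ∀ c, dist x c = dist y c → dist m c < dist x c := by
    intro c hc
    have h := hm1 c
    rw [← hc] at h
    have h1 : 1 < Real.cosh (dist x y / 2) :=
      Real.one_lt_cosh.2 (half_pos (dist_pos.2 hne)).ne'
    have h2 : 0 < Real.cosh (dist m c) := Real.cosh_pos _
    have h3 : Real.cosh (dist m c) < Real.cosh (dist x c) := by nlinarith
    simpa using Real.cosh_lt_cosh.1 h3
  have l1 := hlt z (by rw [dist_comm x, dist_comm y, hyd])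
  have l2 := hlt w (by linarith)
  have := dist_triangle z m w
  rw [dist_comm z m] at this
  rw [dist_comm x z] at l1
  linarith

lemma left_mem_geodSegment (z w : ℍ) : z ∈ geodSegment z w := by simp [geodSegment]

lemma right_mem_geodSegment (z w : ℍ) : w ∈ geodSegment z w := by simp [geodSegment]

lemma geodSegment_comm (z w : ℍ) : geodSegment z w = geodSegment w z := by
  ext x; simp only [geodSegment, Set.mem_ofPred_eq, dist_comm]; rw [add_comm]

lemma geodSegment_subset {z w x y : ℍ} (hx : x ∈ geodSegment z w) (hy : y ∈ geodSegment z w) :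
    geodSegment x y ⊆ geodSegment z w := by
  intro t ht
  rw [mem_geodSegment_iff] at *
  exact (convex_segment _ _).segment_subset hx hy ht

lemma isClosed_geodSegment (z w : ℍ) : IsClosed (geodSegment z w) :=
  isClosed_eq (by fun_prop) (by fun_prop)

lemma isCompact_geodSegment (z w : ℍ) : IsCompact (geodSegment z w) := by
  refine (isCompact_closedBall z (dist z w)).of_isClosed_subset (isClosed_geodSegment z w) ?_
  intro x hx
  have : dist z x + dist x w = dist z w := hx
  rw [Metric.mem_closedBall, dist_comm]
  linarith [dist_nonneg (x := x) (y := w)]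

lemma isPreconnected_geodSegment (z w : ℍ) : IsPreconnected (geodSegment z w) := by
  have : geodSegment z w = kleinInv '' segment ℝ (klein z) (klein w) := by
    ext x
    rw [mem_geodSegment_iff]
    constructor
    · intro h; exact ⟨_, h, kleinInv_klein x⟩
    · rintro ⟨u, hu, rfl⟩
      rwa [klein_kleinInv (segment_subset_kleinDomain z w hu)]
  rw [this]
  exact (convex_segment _ _).isPreconnected.image _
    (continuousOn_kleinInv.mono (segment_subset_kleinDomain z w))

lemma exists_mem_geodSegment_dist_eq (z w : ℍ) {r : ℝ} (h0 : 0 ≤ r) (h1 : r ≤ dist z w) :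
    ∃ x ∈ geodSegment z w, dist z x = r := by
  obtain ⟨x, hx, h⟩ := exists_klein_dist_eq z w h0 h1
  exact ⟨x, mem_geodSegment_iff.2 hx, h⟩

/-- `m` is the midpoint of the segment from `a` to `b`. -/
def IsMid (m a b : ℍ) : Prop := dist a m = dist a b / 2 ∧ dist m b = dist a b / 2

lemma exists_isMid (a b : ℍ) : ∃ m, IsMid m a b := by
  obtain ⟨m, hm, h⟩ := exists_mem_geodSegment_dist_eq a b (r := dist a b / 2) (by positivity)
    (by linarith [dist_nonneg (x := a) (y := b)])
  have : dist a m + dist m b = dist a b := hm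
  exact ⟨m, h, by linarith⟩

lemma IsMid.mem {m a b : ℍ} (h : IsMid m a b) : m ∈ geodSegment a b := by
  change _ + _ = _; rw [h.1, h.2]; ring

lemma IsMid.symm {m a b : ℍ} (h : IsMid m a b) : IsMid m b a := by
  obtain ⟨h1, h2⟩ := h
  constructor <;> rw [dist_comm b a]
  · rw [dist_comm, h2]
  · rw [dist_comm, h1]

lemma IsMid.cosh {m a b : ℍ} (h : IsMid m a b) (c : ℍ) :
    2 * Real.cosh (dist a b / 2) * Real.cosh (dist m c)
      = Real.cosh (dist a c) + Real.cosh (dist b c) :=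
  cosh_dist_of_klein_midpoint (mem_geodSegment_iff.1 h.mem) (by rw [h.1, h.2]) c

/-- The midline of a hyperbolic triangle is at most half as long as the third side. -/
lemma IsMid.dist_le_half {m n a b d : ℍ} (hm : IsMid m a b) (hn : IsMid n a d) :
    dist m n ≤ dist b d / 2 := by
  set x := dist a b / 2
  set y := dist a d / 2
  set z := dist b d / 2
  have h1 := hm.cosh n
  have h2 := hn.cosh b
  have h3 := hn.1
  rw [dist_comm b n, dist_comm a n] at h1
  have e1 : 2 * Real.cosh y * Real.cosh (dist a n) = 1 + Real.cosh (dist a d) := by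
    have := hn.cosh a
    rw [dist_self, Real.cosh_zero, dist_comm n a, dist_comm d a] at this
    exact this
  have dbl : ∀ t : ℝ, Real.cosh t = 2 * Real.cosh (t / 2) ^ 2 - 1 := by
    intro t
    have := Real.cosh_two_mul (t / 2)
    rw [mul_div_cancel₀ t two_ne_zero, Real.sinh_sq] at this
    linarith
  rw [dbl (dist a b), dbl (dist d b), dist_comm d b] at h2
  rw [dbl (dist a d), dist_comm a n] at e1
  have tri1 : z ≤ x + y := by
    have := dist_triangle b a d
    rw [dist_comm b a] at this
    simp only [x, y, z]; linarith
  have tri2 : |x - y| ≤ z := by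
    have h4 := dist_triangle a b d
    have h5 := dist_triangle a d b
    rw [dist_comm d b] at h5
    rw [abs_le]; constructor <;> simp only [x, y, z] <;> linarith
  have c1 : Real.cosh z ≤ Real.cosh (x + y) := by
    rw [Real.cosh_le_cosh, abs_of_nonneg (by positivity), abs_of_nonneg (by positivity)]
    exact tri1
  have c2 : Real.cosh (x - y) ≤ Real.cosh z := by
    rw [Real.cosh_le_cosh, abs_of_nonneg (a := z) (by positivity)]; exact tri2
  rw [Real.cosh_add] at c1
  rw [Real.cosh_sub] at c2
  have sx := Real.sinh_sq x
  have sy := Real.sinh_sq y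
  have px := Real.cosh_pos x
  have py := Real.cosh_pos y
  have pz := Real.cosh_pos z
  rw [← abs_of_nonneg (dist_nonneg (x := m) (y := n)), ← abs_of_nonneg (a := z) (by positivity),
    ← Real.cosh_le_cosh]
  have h2' : 2 * Real.cosh y * Real.cosh (dist n b)
    = 2 * Real.cosh x ^ 2 + 2 * Real.cosh z ^ 2 - 2 := by linarith
  have e1' : 2 * Real.cosh y * Real.cosh (dist n a) = 2 * Real.cosh y ^ 2 := by linarith
  have h1' : 2 * Real.cosh x * Real.cosh (dist m n) = Real.cosh (dist n a) + Real.cosh (dist n b) :=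
    h1
  have gram : Real.cosh x ^ 2 + Real.cosh y ^ 2 + Real.cosh z ^ 2 - 1
      ≤ 2 * Real.cosh x * Real.cosh y * Real.cosh z := by
    have : (Real.cosh z - Real.cosh x * Real.cosh y) ^ 2 ≤ (Real.sinh x * Real.sinh y) ^ 2 := by
      exact sq_le_sq' (by linarith) (by linarith)
    rw [mul_pow, sx, sy] at this
    nlinarith
  have : 4 * Real.cosh x * Real.cosh y * Real.cosh (dist m n)
      ≤ 4 * Real.cosh x * Real.cosh y * Real.cosh z := by
    have : 4 * Real.cosh x * Real.cosh y * Real.cosh (dist m n) =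
        2 * Real.cosh x ^ 2 + 2 * Real.cosh y ^ 2 + 2 * Real.cosh z ^ 2 - 2 := by
      linear_combination 2 * Real.cosh y * h1' + e1' + h2'
    linarith
  exact le_of_mul_le_mul_left this (by positivity)

/-- Midpoints satisfy the Busemann convexity inequality. -/
lemma IsMid.dist_le {m n a b c d : ℍ} (hm : IsMid m a b) (hn : IsMid n c d) :
    dist m n ≤ (dist a c + dist b d) / 2 := by
  obtain ⟨k, hk⟩ := exists_isMid a d
  have h1 := hm.dist_le_half hk
  have h2 := hk.symm.dist_le_half hn.symm
  linarith [dist_triangle m k n]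

/-! ### Half-turns and the comparison of two corners -/

/-- Twice the signed area of the triangle `u v w`. -/
def orient (u v w : ℝ × ℝ) : ℝ := (v.1 - u.1) * (w.2 - u.2) - (v.2 - u.2) * (w.1 - u.1)

lemma orient_swap (u v w : ℝ × ℝ) : orient v u w = -orient u v w := by
  simp only [orient]; ring

lemma orient_swap_right (u v w : ℝ × ℝ) : orient u w v = -orient u v w := by
  simp only [orient]; ring

/-- The point reflection (half-turn) of the hyperbolic plane at `M`. -/
noncomputable def halfTurn (M z : ℍ) : ℍ :=
  ⟨⟨M.re - M.im ^ 2 * (z.re - M.re) / ((z.re - M.re) ^ 2 + z.im ^ 2),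
    M.im ^ 2 * z.im / ((z.re - M.re) ^ 2 + z.im ^ 2)⟩, by
      have := z.im_pos
      have := M.im_pos
      positivity⟩

lemma halfTurn_re (M z : ℍ) : (halfTurn M z).re =
    M.re - M.im ^ 2 * (z.re - M.re) / ((z.re - M.re) ^ 2 + z.im ^ 2) := rfl

lemma halfTurn_im (M z : ℍ) : (halfTurn M z).im =
    M.im ^ 2 * z.im / ((z.re - M.re) ^ 2 + z.im ^ 2) := rfl

/-- In the hyperboloid model the half-turn is `z ↦ 2 ⟨z, M⟩ M - z`. -/
lemma cosh_dist_halfTurn (M z c : ℍ) : Real.cosh (dist (halfTurn M z) c)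
    = 2 * Real.cosh (dist z M) * Real.cosh (dist M c) - Real.cosh (dist z c) := by
  have h1 := z.im_ne_zero
  have h2 := M.im_ne_zero
  have h3 := c.im_ne_zero
  have h4 : (z.re - M.re) ^ 2 + z.im ^ 2 ≠ 0 := by
    have := z.im_pos
    positivity
  simp only [cosh_dist', halfTurn_re, halfTurn_im]
  field_simp
  ring

lemma orient_halfTurn (p q M z : ℍ) :
    orient (klein p) (klein q) (klein (halfTurn M z)) / (halfTurn M z).im
    = 2 * Real.cosh (dist z M) * (orient (klein p) (klein q) (klein M) / M.im)
      - orient (klein p) (klein q) (klein z) / z.im := by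
  have h1 := z.im_ne_zero
  have h2 := M.im_ne_zero
  have h4 : (z.re - M.re) ^ 2 + z.im ^ 2 ≠ 0 := by
    have := z.im_pos
    positivity
  simp only [cosh_dist', orient, klein, halfTurn_re, halfTurn_im]
  field_simp
  ring

lemma dist_eq_of_cosh_eq {a b c d : ℍ} (h : Real.cosh (dist a b) = Real.cosh (dist c d)) :
    dist a b = dist c d :=
  Real.cosh_strictMonoOn.injOn (Set.mem_Ici.2 dist_nonneg) (Set.mem_Ici.2 dist_nonneg) h

lemma dist_halfTurn_center (M z : ℍ) : dist (halfTurn M z) M = dist z M := by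
  apply dist_eq_of_cosh_eq
  rw [cosh_dist_halfTurn, dist_self, Real.cosh_zero]; ring

lemma dist_halfTurn (M z w : ℍ) : dist (halfTurn M z) (halfTurn M w) = dist z w := by
  apply dist_eq_of_cosh_eq
  rw [cosh_dist_halfTurn, dist_comm M, dist_halfTurn_center, dist_comm z (halfTurn M w),
    cosh_dist_halfTurn, dist_comm M z, dist_comm w z]
  ring

lemma halfTurn_halfTurn (M z : ℍ) : halfTurn M (halfTurn M z) = z := by
  apply dist_eq_zero.1
  rw [← dist_self z]
  apply dist_eq_of_cosh_eq
  rw [cosh_dist_halfTurn, dist_halfTurn_center, cosh_dist_halfTurn, dist_comm M z, dist_self,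
    Real.cosh_zero]
  ring

lemma halfTurn_eq_of_isMid {M p q : ℍ} (h : IsMid M p q) : halfTurn M p = q := by
  apply dist_eq_zero.1
  rw [← dist_self q]
  apply dist_eq_of_cosh_eq
  rw [cosh_dist_halfTurn, h.1, h.2, dist_self, Real.cosh_zero]
  have := Real.cosh_two_mul (dist p q / 2)
  rw [mul_div_cancel₀ _ two_ne_zero, Real.sinh_sq] at this
  linarith

lemma isMid_halfTurn (M z : ℍ) : IsMid M (halfTurn M z) z := by
  have h1 : dist (halfTurn M z) M = dist z M := dist_halfTurn_center M z
  have h3 : Real.cosh (dist (halfTurn M z) z) = Real.cosh (2 * dist z M) := by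
    rw [cosh_dist_halfTurn M z z, dist_self, Real.cosh_zero, Real.cosh_two_mul, Real.sinh_sq,
      dist_comm M z]
    ring
  have h4 : dist (halfTurn M z) z = 2 * dist z M :=
    Real.cosh_strictMonoOn.injOn (Set.mem_Ici.2 dist_nonneg) (Set.mem_Ici.2 (by positivity)) h3
  exact ⟨by rw [h1, h4]; ring, by rw [dist_comm M z, h4]; ring⟩

lemma halfTurn_mem_geodSegment {M x a b : ℍ} (h : x ∈ geodSegment a b) :
    halfTurn M x ∈ geodSegment (halfTurn M a) (halfTurn M b) := by
  simp only [geodSegment, Set.mem_ofPred_eq, dist_halfTurn] at *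
  exact h

lemma exists_combo_of_mem {a p r : ℍ} (h : a ∈ geodSegment p r) : ∃ α : ℝ, 0 ≤ α ∧ α ≤ 1 ∧
    klein a = klein p + α • (klein r - klein p) := by
  obtain ⟨s, t, hs, ht, hst, e⟩ := mem_geodSegment_iff.1 h
  refine ⟨t, ht, by linarith, ?_⟩
  rw [← e, show s = 1 - t by linarith]
  module

lemma mem_of_combo {a p r : ℍ} {α : ℝ} (h0 : 0 ≤ α) (h1 : α ≤ 1)
    (e : klein a = klein p + α • (klein r - klein p)) : a ∈ geodSegment p r := by
  rw [mem_geodSegment_iff, e]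
  exact ⟨1 - α, α, by linarith, h0, by ring, by module⟩

lemma exists_pos_combo_of_mem {a p r : ℍ} (h : a ∈ geodSegment p r) (hne : a ≠ p) :
    ∃ α : ℝ, 0 < α ∧ klein a = klein p + α • (klein r - klein p) := by
  obtain ⟨α, h0, -, e⟩ := exists_combo_of_mem h
  refine ⟨α, h0.lt_of_ne ?_, e⟩
  rintro rfl
  exact hne (klein_injective (by simpa using e))

lemma orient_eq_zero_of_mem {p q x : ℍ} (h : x ∈ geodSegment p q) :
    orient (klein p) (klein q) (klein x) = 0 := by
  obtain ⟨α, -, -, e⟩ := exists_combo_of_mem h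
  simp only [orient, e, Prod.fst_add, Prod.snd_add, Prod.smul_fst, Prod.smul_snd, Prod.fst_sub,
    Prod.snd_sub, smul_eq_mul]
  ring

/-- Pasch: in the angle at `q`, either the segment `q t` meets the segment `w x`, or it stays inside
the triangle `q w x`. -/
lemma pasch {q w x t : ℝ × ℝ} (h1 : 0 < orient q w x * orient q w t)
    (h2 : 0 ≤ orient q t x * orient q w x) :
    (∃ y ∈ segment ℝ w x, y ∈ segment ℝ q t) ∨ ∃ y ∈ segment ℝ w x, t ∈ segment ℝ q y := by
  set D := orient q w x with hD
  have hD0 : D ≠ 0 := by rintro h; simp [h] at h1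
  set β := orient q t x / D with hβ
  set γ := orient q w t / D with hγ
  have hβ0 : 0 ≤ β := by
    have : β = orient q t x * D / D ^ 2 := by rw [hβ]; field_simp
    rw [this]; positivity
  have hγ0 : 0 < γ := by
    have : γ = D * orient q w t / D ^ 2 := by rw [hγ]; field_simp
    rw [this]; positivity
  have e : t = q + β • (w - q) + γ • (x - q) := by
    have e1 : β * D = orient q t x := by rw [hβ]; field_simp
    have e2 : γ * D = orient q w t := by rw [hγ]; field_simp
    ext
    · simp only [Prod.fst_add, Prod.smul_fst, Prod.fst_sub, smul_eq_mul]
      apply mul_left_cancel₀ hD0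
      have : D * (q.1 + β * (w.1 - q.1) + γ * (x.1 - q.1)) = D * q.1 + (β * D) * (w.1 - q.1)
        + (γ * D) * (x.1 - q.1) := by ring
      rw [this, e1, e2, hD]
      simp only [orient]
      ring
    · simp only [Prod.snd_add, Prod.smul_snd, Prod.snd_sub, smul_eq_mul]
      apply mul_left_cancel₀ hD0
      have : D * (q.2 + β * (w.2 - q.2) + γ * (x.2 - q.2)) = D * q.2 + (β * D) * (w.2 - q.2)
        + (γ * D) * (x.2 - q.2) := by ring
      rw [this, e1, e2, hD]
      simp only [orient]
      ring
  have hn : 0 < β + γ := by linarith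
  set y := (β / (β + γ)) • w + (γ / (β + γ)) • x with hy
  have hyw : y ∈ segment ℝ w x :=
    ⟨β / (β + γ), γ / (β + γ), by positivity, by positivity, by field_simp, rfl⟩
  have ey : (β + γ) • y = β • w + γ • x := by
    rw [hy, smul_add, smul_smul, smul_smul, mul_div_cancel₀ _ hn.ne', mul_div_cancel₀ _ hn.ne']
  have et : t = (1 - (β + γ)) • q + (β + γ) • y := by rw [ey, e]; module
  rcases le_total (β + γ) 1 with hle | hle
  · exact Or.inr ⟨y, hyw, 1 - (β + γ), β + γ, by linarith, hn.le, by ring, et.symm⟩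
  · refine Or.inl ⟨y, hyw, 1 - 1 / (β + γ), 1 / (β + γ), ?_, by positivity, by ring, ?_⟩
    · rw [sub_nonneg, div_le_one hn]; exact hle
    · have e3 : 1 / (β + γ) * (1 - (β + γ)) = -(1 - 1 / (β + γ)) := by field_simp; ring
      rw [et, smul_add, smul_smul, smul_smul, one_div_mul_cancel hn.ne', e3]
      module

/-- `pasch` for points of the hyperbolic plane. -/
lemma pasch_geodSegment {q w x t : ℍ}
    (h1 : 0 < orient (klein q) (klein w) (klein x) * orient (klein q) (klein w) (klein t))
    (h2 : 0 ≤ orient (klein q) (klein t) (klein x) * orient (klein q) (klein w) (klein x)) :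
    (∃ y ∈ geodSegment w x, y ∈ geodSegment q t) ∨
      ∃ y ∈ geodSegment w x, t ∈ geodSegment q y := by
  rcases pasch h1 h2 with ⟨y, hy, hy'⟩ | ⟨y, hy, hy'⟩
  · refine Or.inl ⟨kleinInv y, ?_, ?_⟩ <;>
    · rw [mem_geodSegment_iff, klein_kleinInv (segment_subset_kleinDomain _ _ hy)]
      assumption
  · refine Or.inr ⟨kleinInv y, ?_, ?_⟩ <;>
    · rw [mem_geodSegment_iff, klein_kleinInv (segment_subset_kleinDomain _ _ hy)]
      assumption

/-- The distance from the midpoint of `p q` to a segment issuing from `p` is at most half the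
distance from `q` to that segment. -/
lemma IsMid.exists_dist_le {M p q r x : ℍ} (hM : IsMid M p q) (hx : x ∈ geodSegment p r) :
    ∃ y ∈ geodSegment p r, 2 * dist M y ≤ dist q x := by
  obtain ⟨y, hy⟩ := exists_isMid p x
  refine ⟨y, geodSegment_subset (left_mem_geodSegment _ _) hx hy.mem, ?_⟩
  linarith [hM.dist_le_half hy]

/-- The distance to a segment `q w` is a midpoint-convex function; hence along a segment issuing
from `q` it is largest at the far end. -/
lemma exists_dist_le_of_mem {q w x t : ℍ} (ht : t ∈ geodSegment q x) :
    ∃ s ∈ geodSegment q w, dist t s ≤ dist x w := by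
  set S := geodSegment q w
  have hS : IsCompact S := isCompact_geodSegment q w
  have hSn : S.Nonempty := ⟨q, left_mem_geodSegment q w⟩
  have hmid : ∀ k u v, IsMid k u v →
      Metric.infDist k S ≤ (Metric.infDist u S + Metric.infDist v S) / 2 := by
    intro k u v hk
    obtain ⟨su, hsu, eu⟩ := hS.exists_infDist_eq_dist hSn u
    obtain ⟨sv, hsv, ev⟩ := hS.exists_infDist_eq_dist hSn v
    obtain ⟨l, hl⟩ := exists_isMid su sv
    rw [eu, ev]
    exact (Metric.infDist_le_dist_of_mem (geodSegment_subset hsu hsv hl.mem)).trans (hk.dist_le hl)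
  have hq : Metric.infDist q S = 0 := Metric.infDist_zero_of_mem (left_mem_geodSegment q w)
  obtain ⟨t0, ht0, hmax⟩ := (isCompact_geodSegment q x).exists_isMaxOn ⟨t, ht⟩
    (Metric.continuous_infDist_pt S).continuousOn
  have hadd : dist q t0 + dist t0 x = dist q x := ht0
  -- Reflecting the nearer end in a maximum point gives another point of the segment.
  have h0 : Metric.infDist t0 S ≤ Metric.infDist x S := by
    rcases le_total (dist q t0) (dist t0 x) with h | h
    · obtain ⟨v, hv, hvd⟩ := exists_mem_geodSegment_dist_eq t0 x dist_nonneg h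
      have hv' : dist t0 v + dist v x = dist t0 x := hv
      have hvm : IsMid t0 q v := by
        have h1 := dist_triangle q v x
        have h2 := dist_triangle q t0 v
        constructor <;> linarith
      have h3 := hmid _ _ _ hvm
      have h4 := hmax (geodSegment_subset ht0 (right_mem_geodSegment q x) hv)
      rw [hq] at h3
      simp only [Set.mem_ofPred_eq] at h4
      have : 0 ≤ Metric.infDist x S := Metric.infDist_nonneg
      linarith
    · rw [dist_comm q t0, dist_comm t0 x] at h
      obtain ⟨v, hv, hvd⟩ := exists_mem_geodSegment_dist_eq t0 q dist_nonneg h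
      have hv' : dist t0 v + dist v q = dist t0 q := hv
      have hvm : IsMid t0 x v := by
        have h1 := dist_triangle x v q
        have h2 := dist_triangle x t0 v
        rw [dist_comm q t0, dist_comm t0 x, dist_comm q x] at hadd
        constructor <;> linarith
      have h3 := hmid _ _ _ hvm
      have h4 := hmax (geodSegment_subset ht0 (left_mem_geodSegment q x) hv)
      simp only [Set.mem_ofPred_eq] at h4
      linarith
  obtain ⟨s, hs, es⟩ := hS.exists_infDist_eq_dist hSn t
  refine ⟨s, hs, ?_⟩
  rw [← es]
  exact ((hmax ht).trans h0).trans (Metric.infDist_le_dist_of_mem (right_mem_geodSegment q w))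

/-- Three points of the plane with vanishing `orient` are collinear. -/
lemma exists_smul_of_orient_eq_zero {p q r : ℍ} (hpq : p ≠ q)
    (h0 : orient (klein p) (klein q) (klein r) = 0) :
    ∃ l : ℝ, klein r - klein p = l • (klein q - klein p) := by
  have hkne : klein q - klein p ≠ 0 := sub_ne_zero.2 fun h => hpq (klein_injective h.symm)
  simp only [orient] at h0
  by_cases h1 : (klein q).1 - (klein p).1 = 0
  · have h2 : (klein q).2 - (klein p).2 ≠ 0 := by
      intro h2
      exact hkne (Prod.ext h1 h2)
    have h3 : (klein r).1 - (klein p).1 = 0 := by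
      rw [h1, zero_mul, zero_sub, neg_eq_zero] at h0
      exact (mul_eq_zero.1 h0).resolve_left h2
    refine ⟨((klein r).2 - (klein p).2) / ((klein q).2 - (klein p).2), Prod.ext ?_ ?_⟩
    · simp [h1, h3]
    · simp only [Prod.snd_sub, Prod.smul_snd, smul_eq_mul]; field_simp
  · refine ⟨((klein r).1 - (klein p).1) / ((klein q).1 - (klein p).1), Prod.ext ?_ ?_⟩
    · simp only [Prod.fst_sub, Prod.smul_fst, smul_eq_mul]; field_simp
    · simp only [Prod.snd_sub, Prod.smul_snd, smul_eq_mul]; field_simp; linarith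

/-- If the segments `p q` and `p r` form a straight angle at `p`, every path from one to the other
passes at least the distance to `p`. -/
lemma dist_le_of_straight {p q r a z : ℍ} (hpq : p ≠ q)
    (h0 : orient (klein p) (klein q) (klein r) = 0)
    (hpr : geodSegment p r ∩ geodSegment p q = {p}) (ha : a ∈ geodSegment p r)
    (hz : z ∈ geodSegment p q) : dist p z ≤ dist a z := by
  have hkne : klein q - klein p ≠ 0 := sub_ne_zero.2 fun h => hpq (klein_injective h.symm)
  obtain ⟨l, hl⟩ := exists_smul_of_orient_eq_zero hpq h0
  have hl0 : l ≤ 0 := by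
    by_contra! hl0
    -- Otherwise the two segments overlap.
    set μ := min l 1
    have hμ0 : 0 < μ := lt_min hl0 one_pos
    set u := klein p + μ • (klein q - klein p) with hu
    have hu1 : u ∈ segment ℝ (klein p) (klein q) :=
      ⟨1 - μ, μ, by linarith [min_le_right l 1], hμ0.le, by ring, by rw [hu]; module⟩
    have e := klein_kleinInv (segment_subset_kleinDomain _ _ hu1)
    have m1 : kleinInv u ∈ geodSegment p q := by rwa [mem_geodSegment_iff, e]
    have m2 : kleinInv u ∈ geodSegment p r := by
      refine mem_of_combo (α := μ / l) (by positivity) ?_ ?_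
      · rw [div_le_one hl0]; exact min_le_left _ _
      · rw [e, hl, smul_smul, div_mul_cancel₀ _ hl0.ne']
    have m3 : kleinInv u = p := by
      have : kleinInv u ∈ geodSegment p r ∩ geodSegment p q := ⟨m2, m1⟩
      rwa [hpr] at this
    rw [m3, hu] at e
    have : μ • (klein q - klein p) = 0 := by simpa using e
    exact (smul_ne_zero hμ0.ne' hkne) this
  obtain ⟨α, hα, -, ea⟩ := exists_combo_of_mem ha
  obtain ⟨ζ, hζ, -, ez⟩ := exists_combo_of_mem hz
  rw [hl, smul_smul] at ea
  have hp : p ∈ geodSegment a z := by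
    rcases (show 0 ≤ ζ - α * l by nlinarith [mul_nonneg hα (neg_nonneg.2 hl0)]).eq_or_lt with h | h
    · have h1 : α * l = 0 := by nlinarith [mul_nonneg hα (neg_nonneg.2 hl0)]
      have : a = p := klein_injective (by rw [ea, h1, zero_smul, add_zero])
      rw [this]; exact left_mem_geodSegment _ _
    · refine mem_of_combo (α := (-(α * l)) / (ζ - α * l)) ?_ ?_ ?_
      · exact div_nonneg (by nlinarith [mul_nonneg hα (neg_nonneg.2 hl0)]) h.le
      · rw [div_le_one h]; linarith
      · have : klein z - klein a = (ζ - α * l) • (klein q - klein p) := by rw [ez, ea]; module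
        rw [this, smul_smul, div_mul_cancel₀ _ h.ne', ea]
        module
  have : dist a p + dist p z = dist a z := hp
  linarith [dist_nonneg (x := a) (y := p)]

/-- Two corners of adjacent tiles at the two ends of a common side `p q`: a path that crosses the
first tile from the side `p r` to the common side, and then the second tile to its side `q t`, is
not shorter than the relevant double distances of midpoints. The half-turn at the midpoint of `p q`
brings the two corners into the same half-plane, where they are compared. -/
theorem le_dist_add_dist_of_corners {m : ℝ} {p q r t z a b M : ℍ} (hpq : p ≠ q)
    (hM : IsMid M p q) (hz : z ∈ geodSegment p q) (ha : a ∈ geodSegment p r)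
    (hb : b ∈ geodSegment q t)
    (hA : ∀ x ∈ geodSegment p r, m ≤ 2 * dist M x) (hB : ∀ x ∈ geodSegment q t, m ≤ 2 * dist M x)
    (hr : ∀ x ∈ geodSegment p q, m ≤ dist r x) (ht : ∀ x ∈ geodSegment p q, m ≤ dist t x)
    (hpr : geodSegment p r ∩ geodSegment p q = {p})
    (hqt : geodSegment q t ∩ geodSegment q p = {q})
    (hopp : orient (klein p) (klein q) (klein r) * orient (klein p) (klein q) (klein t) ≤ 0) :
    m ≤ dist a z + dist z b := by
  have hzq : z ∈ geodSegment q p := by rwa [geodSegment_comm]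
  have hpB : m ≤ dist p b := by
    obtain ⟨y, hy, hyd⟩ := hM.symm.exists_dist_le hb
    exact (hB y hy).trans hyd
  have hqA : m ≤ dist a q := by
    obtain ⟨y, hy, hyd⟩ := hM.exists_dist_le ha
    rw [dist_comm]
    exact (hA y hy).trans hyd
  have fromp : dist p z ≤ dist a z → m ≤ dist a z + dist z b := fun h => by
    linarith [dist_triangle p z b]
  have fromq : dist q z ≤ dist b z → m ≤ dist a z + dist z b := fun h => by
    rw [dist_comm b z, dist_comm q z] at h
    linarith [dist_triangle a z q]
  by_cases hor : orient (klein p) (klein q) (klein r) = 0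
  · exact fromp (dist_le_of_straight hpq hor hpr ha hz)
  by_cases hot : orient (klein p) (klein q) (klein t) = 0
  · exact fromq (dist_le_of_straight hpq.symm (by rw [orient_swap, hot, neg_zero]) hqt hb hzq)
  by_cases hap : a = p
  · exact fromp (by rw [hap])
  by_cases hbq : b = q
  · exact fromq (by rw [hbq])
  by_cases hzp : z = p
  · exact fromp (by rw [hzp, dist_self]; exact dist_nonneg)
  by_cases hzq' : z = q
  · exact fromq (by rw [hzq', dist_self]; exact dist_nonneg)
  have ρp : halfTurn M p = q := halfTurn_eq_of_isMid hM
  have ρq : halfTurn M q = p := halfTurn_eq_of_isMid hM.symm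
  set w := halfTurn M z with hw
  set x := halfTurn M a with hx
  set r' := halfTurn M r with hr'
  have hwm : w ∈ geodSegment q p := by
    have := halfTurn_mem_geodSegment (M := M) hz
    rwa [ρp, ρq] at this
  have hwpq : w ∈ geodSegment p q := by rwa [geodSegment_comm]
  have hxm : x ∈ geodSegment q r' := by
    have := halfTurn_mem_geodSegment (M := M) ha
    rwa [ρp] at this
  have hwq : w ≠ q := by
    intro h
    apply hzp
    rw [← halfTurn_halfTurn M z, ← hw, h, ρq]
  have hxq : x ≠ q := by
    intro h
    apply hap
    rw [← halfTurn_halfTurn M a, ← hx, h, ρq]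
  have hdax : dist a z = dist w x := by rw [hw, hx, dist_halfTurn, dist_comm]
  obtain ⟨ω, hω, ew⟩ := exists_pos_combo_of_mem hwm hwq
  obtain ⟨ξ, hξ, ex⟩ := exists_pos_combo_of_mem hxm hxq
  obtain ⟨ζ, hζ, ez⟩ := exists_pos_combo_of_mem hzq hzq'
  obtain ⟨β, hβ, eb⟩ := exists_pos_combo_of_mem hb hbq
  -- The half-turn exchanges the two sides of the line through `p` and `q`.
  obtain ⟨κ, hκ, er⟩ : ∃ κ : ℝ, 0 < κ ∧ orient (klein q) (klein p) (klein r')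
      = κ * orient (klein p) (klein q) (klein r) := by
    have h := orient_halfTurn p q M r
    rw [orient_eq_zero_of_mem hM.mem, zero_div, mul_zero, zero_sub, ← hr'] at h
    refine ⟨r'.im / r.im, div_pos r'.im_pos r.im_pos, ?_⟩
    rw [orient_swap]
    have h1 := r.im_ne_zero
    have h2 := r'.im_ne_zero
    field_simp at h ⊢
    linarith
  set o := orient (klein p) (klein q) (klein r)
  set o' := orient (klein p) (klein q) (klein t) with ho'
  have hoo : 0 < o * -o' := by
    have : o * o' ≠ 0 := mul_ne_zero hor hot
    have := lt_of_le_of_ne hopp this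
    linarith
  have simpset : ∀ u v : ℝ × ℝ, ∀ s : ℝ, (u + s • (v - u)).1 = u.1 + s * (v.1 - u.1) ∧
      (u + s • (v - u)).2 = u.2 + s * (v.2 - u.2) := by intro u v s; simp
  have f1 : orient (klein q) (klein w) (klein x) = ω * ξ * (κ * o) := by
    rw [← er, ew, ex]; simp only [orient, simpset]; ring
  have f2 : orient (klein q) (klein w) (klein t) = ω * -o' := by
    rw [ho', ← orient_swap, ew]; simp only [orient, simpset]; ring
  have f3 : orient (klein q) (klein t) (klein x)
      = ξ * orient (klein q) (klein t) (klein r') := by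
    rw [ex]; simp only [orient, simpset]; ring
  have f4 : orient (klein q) (klein z) (klein b) = ζ * β * -o' := by
    rw [ho', ← orient_swap, ez, eb]; simp only [orient, simpset]; ring
  have f5 : orient (klein q) (klein z) (klein r') = ζ * (κ * o) := by
    rw [← er, ez]; simp only [orient, simpset]; ring
  have f6 : orient (klein q) (klein r') (klein b)
      = β * -orient (klein q) (klein t) (klein r') := by
    rw [← orient_swap_right, eb]; simp only [orient, simpset]; ring
  set j := orient (klein q) (klein t) (klein r')
  -- As `o` and `o'` have opposite signs, a sign condition on one is one on the other.
  have hsq : ∀ c : ℝ, 0 ≤ c * o → c * o' ≤ 0 := by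
    intro c hc
    by_contra! h
    nlinarith [mul_nonneg hc h.le, mul_pos h hoo, sq_nonneg o, sq_nonneg o', sq_nonneg c,
      mul_nonneg (sq_nonneg c) hoo.le, mul_pos h (show 0 < -(o * o') by linarith)]
  rcases le_total 0 (j * o) with hj | hj
  · -- The segment `q r'` makes the larger angle with `q p`.
    have g1 : 0 < orient (klein q) (klein w) (klein x) * orient (klein q) (klein w) (klein t) := by
      rw [f1, f2]
      have : ω * ξ * (κ * o) * (ω * -o') = (ω * ξ * κ * ω) * (o * -o') := by ring
      rw [this]; positivity
    have g2 : 0 ≤ orient (klein q) (klein t) (klein x) * orient (klein q) (klein w) (klein x) := by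
      rw [f1, f3]
      have : ξ * j * (ω * ξ * (κ * o)) = (ξ * ω * ξ * κ) * (j * o) := by ring
      rw [this]; positivity
    rw [hdax]
    rcases pasch_geodSegment g1 g2 with ⟨y, hy, hyB⟩ | ⟨y, hy, hty⟩
    · obtain ⟨n, hn⟩ := exists_isMid y b
      have h1 := (isMid_halfTurn M z).dist_le hn
      have h2 := hB n (geodSegment_subset hyB hb hn.mem)
      have h3 : dist w y + dist y x = dist w x := hy
      linarith [dist_nonneg (x := y) (y := x)]
    · obtain ⟨s, hs, hsd⟩ := exists_dist_le_of_mem (w := w) hty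
      have h2 := ht s (geodSegment_subset (right_mem_geodSegment p q) hwpq hs)
      have h3 : dist w y + dist y x = dist w x := hy
      rw [dist_comm y w] at hsd
      linarith [dist_nonneg (x := y) (y := x), dist_nonneg (x := z) (y := b)]
  · -- The segment `q t` makes the larger angle with `q p`.
    have g1 : 0 < orient (klein q) (klein z) (klein b) * orient (klein q) (klein z) (klein r') := by
      rw [f4, f5]
      have : ζ * β * -o' * (ζ * (κ * o)) = (ζ * β * κ * ζ) * (o * -o') := by ring
      rw [this]; positivity
    have g2 : 0 ≤ orient (klein q) (klein r') (klein b) * orient (klein q) (klein z) (klein b) := by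
      rw [f4, f6]
      have h1 := hsq (-j) (by linarith)
      have : β * -j * (ζ * β * -o') = (β * ζ * β) * (-(-j * o')) := by ring
      rw [this]
      have : 0 ≤ -(-j * o') := by linarith
      positivity
    rw [hdax]
    rcases pasch_geodSegment g1 g2 with ⟨y, hy, hyA⟩ | ⟨y, hy, hry⟩
    · obtain ⟨n, hn⟩ := exists_isMid x y
      have h1 := (isMid_halfTurn M z).dist_le hn
      have h2 : m ≤ 2 * dist M (halfTurn M n) := by
        apply hA
        have := halfTurn_mem_geodSegment (M := M) (geodSegment_subset hxm hyA hn.mem)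
        rwa [ρq, hr', halfTurn_halfTurn] at this
      rw [dist_comm, dist_halfTurn_center, dist_comm] at h2
      have h3 : dist z y + dist y b = dist z b := hy
      linarith [dist_nonneg (x := y) (y := b)]
    · obtain ⟨s, hs, hsd⟩ := exists_dist_le_of_mem (w := z) hry
      have h2 : m ≤ dist r (halfTurn M s) := by
        apply hr
        have := halfTurn_mem_geodSegment (M := M)
          (geodSegment_subset (left_mem_geodSegment q p) hzq hs)
        rwa [ρq, ρp] at this
      rw [← dist_halfTurn M, halfTurn_halfTurn, ← hr'] at h2
      have h3 : dist z y + dist y b = dist z b := hy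
      rw [dist_comm y z] at hsd
      linarith [dist_nonneg (x := y) (y := b), dist_nonneg (x := w) (y := x)]

/-! ### Convex polygons near their sides -/

/-- The path that runs through the segment from `x` to `y` with constant speed in the chart. -/
noncomputable def geodPath (x y : ℍ) (t : ℝ) : ℍ :=
  kleinInv (AffineMap.lineMap (klein x) (klein y) t)

lemma lineMap_mem_segment (x y : ℍ) {t : ℝ} (ht : t ∈ Set.Icc (0 : ℝ) 1) :
    AffineMap.lineMap (klein x) (klein y) t ∈ segment ℝ (klein x) (klein y) := by
  rw [segment_eq_image_lineMap]; exact ⟨t, ht, rfl⟩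

lemma klein_geodPath (x y : ℍ) {t : ℝ} (ht : t ∈ Set.Icc (0 : ℝ) 1) :
    klein (geodPath x y t) = AffineMap.lineMap (klein x) (klein y) t :=
  klein_kleinInv (segment_subset_kleinDomain x y (lineMap_mem_segment x y ht))

lemma geodPath_zero (x y : ℍ) : geodPath x y 0 = x := by simp [geodPath, kleinInv_klein]

lemma geodPath_one (x y : ℍ) : geodPath x y 1 = y := by simp [geodPath, kleinInv_klein]

lemma continuousOn_geodPath (x y : ℍ) : ContinuousOn (geodPath x y) (Set.Icc 0 1) := by
  refine continuousOn_kleinInv.comp (Continuous.continuousOn ?_) fun t ht =>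
    segment_subset_kleinDomain x y (lineMap_mem_segment x y ht)
  exact AffineMap.lineMap_continuous

lemma geodPath_mem_geodSegment (x y : ℍ) {r s t : ℝ} (hr : r ∈ Set.Icc (0 : ℝ) 1)
    (ht : t ∈ Set.Icc (0 : ℝ) 1) (hs : s ∈ Set.Icc r t) :
    geodPath x y s ∈ geodSegment (geodPath x y r) (geodPath x y t) := by
  have hs' : s ∈ Set.Icc (0 : ℝ) 1 := ⟨hr.1.trans hs.1, hs.2.trans ht.2⟩
  rw [mem_geodSegment_iff, klein_geodPath x y hr, klein_geodPath x y hs', klein_geodPath x y ht]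
  have : s ∈ segment ℝ r t := by
    rw [segment_eq_Icc (hs.1.trans hs.2)]; exact hs
  obtain ⟨a, b, ha, hb, hab, rfl⟩ := this
  refine ⟨a, b, ha, hb, hab, ?_⟩
  simp only [AffineMap.lineMap_apply_module, smul_eq_mul]
  have : a = 1 - b := by linarith
  subst this
  module

lemma dist_geodPath_add (x y : ℍ) {r s : ℝ} (hr : 0 ≤ r) (hrs : r ≤ s) (hs : s ≤ 1) :
    dist x (geodPath x y r) + dist (geodPath x y r) (geodPath x y s) + dist (geodPath x y s) y
      = dist x y := by
  have h1 : dist (geodPath x y 0) (geodPath x y s) + dist (geodPath x y s) (geodPath x y 1)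
      = dist (geodPath x y 0) (geodPath x y 1) :=
    geodPath_mem_geodSegment x y (by simp) (by simp) ⟨hr.trans hrs, hs⟩
  have h2 : dist (geodPath x y 0) (geodPath x y r) + dist (geodPath x y r) (geodPath x y s)
      = dist (geodPath x y 0) (geodPath x y s) :=
    geodPath_mem_geodSegment x y (by simp) ⟨hr.trans hrs, hs⟩ ⟨hr, hrs⟩
  rw [geodPath_zero] at h1 h2
  rw [geodPath_one] at h1
  linarith

/-- The end points of a segment are determined by the segment as a set. -/
lemma eq_or_eq_of_geodSegment_eq {a b c d : ℍ} (h : geodSegment a b = geodSegment c d) :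
    (a = c ∧ b = d) ∨ (a = d ∧ b = c) := by
  have ha : a ∈ geodSegment c d := h ▸ left_mem_geodSegment a b
  have ha : dist c a + dist a d = dist c d := ha
  have hb : b ∈ geodSegment c d := h ▸ right_mem_geodSegment a b
  have hb : dist c b + dist b d = dist c d := hb
  have hc : c ∈ geodSegment a b := h.symm ▸ left_mem_geodSegment c d
  have hc : dist a c + dist c b = dist a b := hc
  have hd : d ∈ geodSegment a b := h.symm ▸ right_mem_geodSegment c d
  have hd : dist a d + dist d b = dist a b := hd
  rw [dist_comm c a] at ha
  rw [dist_comm d b] at hd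
  have h1 : dist a b = dist c d := by linarith
  have hbc : dist b d = dist a c := by linarith
  -- The point `a` is as far from `c` as `b` is from `d`; compare the positions on `c d`.
  by_cases hac : a = c
  · exact Or.inl ⟨hac, dist_eq_zero.1 (by rw [hbc, hac, dist_self])⟩
  have hac' := dist_pos.2 hac
  obtain ⟨s, hs0, hs1, es⟩ := exists_combo_of_mem (show a ∈ geodSegment c d from
    h ▸ left_mem_geodSegment a b)
  obtain ⟨t, ht0, ht1, et⟩ := exists_combo_of_mem (show b ∈ geodSegment c d from
    h ▸ right_mem_geodSegment a b)
  have hcm : c ∈ geodSegment a b := h.symm ▸ left_mem_geodSegment c d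
  have hdm : d ∈ geodSegment a b := h.symm ▸ right_mem_geodSegment c d
  obtain ⟨α, hα0, hα1, ec⟩ := exists_combo_of_mem hcm
  obtain ⟨δ, hδ0, hδ1, ed⟩ := exists_combo_of_mem hdm
  have hcd : klein d - klein c ≠ 0 := by
    intro h0
    have : d = c := klein_injective (sub_eq_zero.1 h0)
    subst this
    rw [dist_self] at ha
    linarith [dist_nonneg (x := a) (y := d)]
  rw [es, et] at ec ed
  have k1 : (s + α * (t - s)) • (klein d - klein c) = 0 := by
    have : klein c + s • (klein d - klein c) + α • (klein c + t • (klein d - klein c)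
      - (klein c + s • (klein d - klein c))) - klein c = 0 := by rw [← ec, sub_self]
    rw [← this]; module
  have k2 : (s + δ * (t - s) - 1) • (klein d - klein c) = 0 := by
    have : klein c + s • (klein d - klein c) + δ • (klein c + t • (klein d - klein c)
      - (klein c + s • (klein d - klein c))) - klein d = 0 := by rw [← ed, sub_self]
    rw [← this]; module
  have k1 := (smul_eq_zero.1 k1).resolve_right hcd
  have k2 := (smul_eq_zero.1 k2).resolve_right hcd
  have hs : s ≠ 0 := by
    rintro rfl
    exact hac (klein_injective (by rw [es]; simp))
  have hs' : 0 < s := lt_of_le_of_ne hs0 hs.symm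
  have hα : α = 1 := by
    have h3 : s * (1 - α) = 0 := by
      nlinarith [mul_nonneg hs0 (sub_nonneg.2 hα1), mul_nonneg hα0 ht0]
    linarith [(mul_eq_zero.1 h3).resolve_left hs]
  have ht' : t = 0 := by rw [hα] at k1; linarith
  have hs1' : s = 1 := by rw [ht'] at k2; nlinarith
  exact Or.inr ⟨klein_injective (by rw [es, hs1']; module),
    klein_injective (by rw [et, ht']; module)⟩

lemma continuous_orient (p q : ℝ × ℝ) : Continuous fun x : ℍ => orient p q (klein x) := by
  have := continuous_klein
  unfold orient
  fun_prop

/-- Near a point of the open segment `p q`, one side of the line `p q` is covered by any convex set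
that contains the segment and a point on that side. -/
lemma eventually_mem_of_convex {C : Set (ℝ × ℝ)} (hC : Convex ℝ C) {p q z : ℍ} {o : ℝ × ℝ}
    (hp : klein p ∈ C) (hq : klein q ∈ C) (ho : o ∈ C) (hD : orient (klein p) (klein q) o ≠ 0)
    (hz : z ∈ geodSegment p q) (hzp : z ≠ p) (hzq : z ≠ q) :
    ∀ᶠ x in 𝓝 z,
      (0 ≤ orient (klein p) (klein q) (klein x) * orient (klein p) (klein q) o → klein x ∈ C) ∧
      (orient (klein p) (klein q) (klein x) = 0 → x ∈ geodSegment p q) := by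
  set D := orient (klein p) (klein q) o with hDdef
  have simpset : ∀ u v : ℝ × ℝ, ∀ s : ℝ, (u + s • (v - u)).1 = u.1 + s * (v.1 - u.1) ∧
      (u + s • (v - u)).2 = u.2 + s * (v.2 - u.2) := by intro u v s; simp
  obtain ⟨ζ, hζ, ez⟩ := exists_pos_combo_of_mem hz hzp
  obtain ⟨ω, hω, ez'⟩ := exists_pos_combo_of_mem (by rwa [geodSegment_comm] at hz) hzq
  have c1 : Continuous fun x : ℍ => orient (klein q) o (klein x) / D :=
    (continuous_orient _ _).div_const _
  have c2 : Continuous fun x : ℍ => orient o (klein p) (klein x) / D :=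
    (continuous_orient _ _).div_const _
  have v1 : orient (klein q) o (klein z) / D = ω := by
    rw [div_eq_iff hD, ez', hDdef]; simp only [orient, simpset]; ring
  have v2 : orient o (klein p) (klein z) / D = ζ := by
    rw [div_eq_iff hD, ez, hDdef]; simp only [orient, simpset]; ring
  filter_upwards [c1.continuousAt.eventually (lt_mem_nhds (v1 ▸ hω)),
    c2.continuousAt.eventually (lt_mem_nhds (v2 ▸ hζ))] with x h1 h2
  set α := orient (klein q) o (klein x) / D
  set β := orient o (klein p) (klein x) / D
  set γ := orient (klein p) (klein q) (klein x) / D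
  have hsum : α + β + γ = 1 := by
    simp only [α, β, γ]
    rw [← add_div, ← add_div, div_eq_one_iff_eq hD, hDdef]
    simp only [orient]; ring
  have ex : klein x = α • klein p + β • klein q + γ • o := by
    have hα : D * α = orient (klein q) o (klein x) := mul_div_cancel₀ _ hD
    have hβ : D * β = orient o (klein p) (klein x) := mul_div_cancel₀ _ hD
    have hγ : D * γ = orient (klein p) (klein q) (klein x) := mul_div_cancel₀ _ hD
    ext
    · apply mul_left_cancel₀ hD
      simp only [Prod.fst_add, Prod.smul_fst, smul_eq_mul, mul_add, ← mul_assoc, hα, hβ, hγ]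
      rw [hDdef]; simp only [orient]; ring
    · apply mul_left_cancel₀ hD
      simp only [Prod.snd_add, Prod.smul_snd, smul_eq_mul, mul_add, ← mul_assoc, hα, hβ, hγ]
      rw [hDdef]; simp only [orient]; ring
  refine ⟨fun h => ?_, fun h => ?_⟩
  · have hγ : 0 ≤ γ := by
      have : γ = orient (klein p) (klein q) (klein x) * D / D ^ 2 := by
        simp only [γ]; field_simp
      rw [this]; positivity
    rw [ex]
    have := hC.sum_mem (t := Finset.univ) (w := ![α, β, γ]) (z := ![klein p, klein q, o])
      (by intro i _; fin_cases i <;> simp [h1.le, h2.le, hγ])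
      (by simpa [Fin.sum_univ_three] using hsum)
      (by intro i _; fin_cases i <;> simp [hp, hq, ho])
    simpa [Fin.sum_univ_three] using this
  · have hγ : γ = 0 := by simp only [γ]; rw [h, zero_div]
    rw [hγ, zero_smul, add_zero] at ex
    rw [hγ, add_zero] at hsum
    rw [mem_geodSegment_iff, ex]
    exact ⟨α, β, h1.le, h2.le, hsum, rfl⟩

/-- A line has no interior. -/
lemma exists_orient_ne_zero {p q o : ℍ} (ho : orient (klein p) (klein q) (klein o) ≠ 0) {W : Set ℍ}
    (hW : IsOpen W) (hne : W.Nonempty) : ∃ x ∈ W, orient (klein p) (klein q) (klein x) ≠ 0 := by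
  obtain ⟨x, hx⟩ := hne
  by_cases h : orient (klein p) (klein q) (klein x) = 0
  · have hc := continuousOn_geodPath x o 0 (by simp)
    have h1 : ∀ᶠ t in 𝓝[Set.Icc 0 1] (0 : ℝ), geodPath x o t ∈ W :=
      hc.eventually (by rw [geodPath_zero]; exact hW.mem_nhds hx)
    have h2 : ∀ᶠ t in 𝓝[Set.Ioc 0 1] (0 : ℝ), geodPath x o t ∈ W :=
      h1.filter_mono (nhdsWithin_mono _ Set.Ioc_subset_Icc_self)
    have h3 : ∀ᶠ t in 𝓝[Set.Ioc 0 1] (0 : ℝ), t ∈ Set.Ioc (0 : ℝ) 1 := self_mem_nhdsWithin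
    have : (𝓝[Set.Ioc 0 1] (0 : ℝ)).NeBot := by
      rw [nhdsWithin_Ioc_eq_nhdsGT one_pos]; infer_instance
    obtain ⟨t, htW, ht⟩ := (h2.and h3).exists
    refine ⟨_, htW, ?_⟩
    rw [klein_geodPath x o (Set.Ioc_subset_Icc_self ht)]
    have : orient (klein p) (klein q) (AffineMap.lineMap (klein x) (klein o) t)
        = (1 - t) * orient (klein p) (klein q) (klein x)
          + t * orient (klein p) (klein q) (klein o) := by
      simp only [orient, AffineMap.lineMap_apply_module, Prod.fst_add, Prod.snd_add, Prod.smul_fst,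
        Prod.smul_snd, smul_eq_mul]
      ring
    rw [this, h, mul_zero, zero_add]
    exact mul_ne_zero ht.1.ne' ho
  · exact ⟨x, hx, h⟩

lemma klein_image_interior (P : Set ℍ) : klein '' interior P = interior (klein '' P) := by
  apply Set.Subset.antisymm (isOpenMap_klein.image_interior_subset P)
  intro u hu
  obtain ⟨x, hx, rfl⟩ := interior_subset hu
  refine ⟨x, ?_, rfl⟩
  have h : interior (klein ⁻¹' (klein '' P)) = klein ⁻¹' interior (klein '' P) :=
    (isOpenMap_klein.preimage_interior_eq_interior_preimage continuous_klein _).symm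
  rw [Set.preimage_image_eq _ klein_injective] at h
  rw [h]; exact hu

namespace IsConvexPolygon

variable {N : ℕ} {P : Set ℍ} {v : ZMod N → ℍ}

lemma neZero (hP : IsConvexPolygon P v) : NeZero N := ⟨by have := hP.three_le; omega⟩

lemma one_ne_zero (hP : IsConvexPolygon P v) : (1 : ZMod N) ≠ 0 := by
  have := hP.three_le
  have : Fact (1 < N) := ⟨by omega⟩
  exact _root_.one_ne_zero

lemma vertex_ne (hP : IsConvexPolygon P v) (i : ZMod N) : v i ≠ v (i + 1) := fun h =>
  hP.one_ne_zero (by simpa using hP.vertex_injective h)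

lemma isClosed (hP : IsConvexPolygon P v) : IsClosed P := hP.isCompact.isClosed

lemma side_subset (hP : IsConvexPolygon P v) (i : ZMod N) : side v i ⊆ P := by
  refine Set.Subset.trans ?_ hP.isClosed.frontier_subset
  rw [hP.frontier_eq]
  exact Set.subset_iUnion _ i

lemma vertex_mem (hP : IsConvexPolygon P v) (i : ZMod N) : v i ∈ P :=
  hP.side_subset i (left_mem_geodSegment _ _)

lemma mem_interior_or (hP : IsConvexPolygon P v) {x : ℍ} (hx : x ∈ P) :
    x ∈ interior P ∨ ∃ i, x ∈ side v i := by
  by_cases h : x ∈ interior P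
  · exact Or.inl h
  · right
    have : x ∈ frontier P := by
      rw [frontier, hP.isClosed.closure_eq]; exact ⟨hx, h⟩
    rw [hP.frontier_eq] at this
    simpa using this

lemma notMem_side_of_mem_interior (hP : IsConvexPolygon P v) {x : ℍ} (hx : x ∈ interior P)
    (i : ZMod N) : x ∉ side v i := by
  intro h
  have : x ∈ frontier P := by
    rw [hP.frontier_eq]; exact Set.mem_iUnion.2 ⟨i, h⟩
  exact this.2 hx

lemma vertex_mem_side (hP : IsConvexPolygon P v) {i j : ZMod N} (h : v j ∈ side v i) :
    j = i ∨ j = i + 1 := by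
  by_contra! hne
  by_cases hadj : Adjacent i j
  · rcases hadj with h1 | h1
    · exact hne.2 h1
    · obtain rfl : i = j + 1 := by rw [h1]; ring
      have : v j ∈ side v j ∩ side v (j + 1) := ⟨left_mem_geodSegment _ _, h⟩
      rw [hP.side_inter_next] at this
      exact hP.vertex_ne j this
  · exact Set.disjoint_left.1 (hP.side_disjoint i j hne.1.symm hadj) h (left_mem_geodSegment _ _)

lemma exists_vertex_of_mem_sides (hP : IsConvexPolygon P v) {i j : ZMod N} (hij : i ≠ j) {x : ℍ}
    (hi : x ∈ side v i) (hj : x ∈ side v j) : ∃ k, x = v k := by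
  by_cases hadj : Adjacent i j
  · rcases hadj with h1 | h1
    · subst h1
      have : x ∈ side v i ∩ side v (i + 1) := ⟨hi, hj⟩
      rw [hP.side_inter_next] at this
      exact ⟨_, this⟩
    · obtain rfl : i = j + 1 := by rw [h1]; ring
      have : x ∈ side v j ∩ side v (j + 1) := ⟨hj, hi⟩
      rw [hP.side_inter_next] at this
      exact ⟨_, this⟩
  · exact (Set.disjoint_left.1 (hP.side_disjoint i j hij hadj) hi hj).elim

lemma convex_image (hP : IsConvexPolygon P v) : Convex ℝ (klein '' P) := by
  rw [convex_iff_segment_subset]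
  rintro _ ⟨x, hx, rfl⟩ _ ⟨y, hy, rfl⟩ u hu
  have e := klein_kleinInv (segment_subset_kleinDomain x y hu)
  refine ⟨kleinInv u, hP.convex x hx y hy ?_, e⟩
  rwa [mem_geodSegment_iff, e]

lemma subset_closure_interior (hP : IsConvexPolygon P v) : P ⊆ closure (interior P) := by
  intro x hx
  have hne : (interior (klein '' P)).Nonempty := by
    rw [← klein_image_interior]; exact hP.interior_nonempty.image _
  have h := hP.convex_image.closure_interior_eq_closure_of_nonempty_interior hne
  have hx' : klein x ∈ closure (klein '' interior P) := by
    rw [klein_image_interior, h]; exact subset_closure ⟨x, hx, rfl⟩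
  have := isOpenMap_klein.preimage_closure_eq_closure_preimage continuous_klein
    (klein '' interior P)
  rw [Set.preimage_image_eq _ klein_injective] at this
  rw [← this]; exact hx'

/-- Every side lies on a supporting line of the polygon. -/
lemma exists_supporting (hP : IsConvexPolygon P v) (i : ZMod N) : ∃ σ : ℝ,
    (∀ x ∈ P, 0 ≤ σ * orient (klein (v i)) (klein (v (i + 1))) (klein x)) ∧
    ∀ x ∈ interior P, 0 < σ * orient (klein (v i)) (klein (v (i + 1))) (klein x) := by
  obtain ⟨M, hM⟩ := exists_isMid (v i) (v (i + 1))
  have hMi : klein M ∉ klein '' interior P := by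
    rintro ⟨x, hx, e⟩
    rw [klein_injective e] at hx
    exact hP.notMem_side_of_mem_interior hx i hM.mem
  have ho : IsOpen (klein '' interior P) := isOpenMap_klein _ isOpen_interior
  have hc : Convex ℝ (klein '' interior P) := by
    rw [klein_image_interior]; exact hP.convex_image.interior
  obtain ⟨f, hf⟩ := geometric_hahn_banach_open_point hc ho hMi
  have hle : ∀ x ∈ P, f (klein x) ≤ f (klein M) := by
    intro x hx
    have hcl : IsClosed {x : ℍ | f (klein x) ≤ f (klein M)} :=
      isClosed_le (f.continuous.comp continuous_klein) continuous_const
    exact hcl.closure_subset_iff.2 (fun y hy => (hf _ ⟨y, hy, rfl⟩).le)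
      (hP.subset_closure_interior hx)
  obtain ⟨s, hs0, hs1, e⟩ := exists_combo_of_mem hM.mem
  have hMne : M ≠ v i ∧ M ≠ v (i + 1) := by
    have := dist_pos.2 (hP.vertex_ne i)
    constructor <;> rintro rfl
    · have := hM.1; rw [dist_self] at this; linarith
    · have := hM.2; rw [dist_self] at this; linarith
  have hs0' : 0 < s := hs0.lt_of_ne fun h => hMne.1 (klein_injective (by rw [e, ← h]; module))
  have hs1' : s < 1 := hs1.lt_of_ne fun h => hMne.2 (klein_injective (by rw [e, h]; module))
  have l1 := hle _ (hP.vertex_mem i)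
  have l2 := hle _ (hP.vertex_mem (i + 1))
  have fe : f (klein M) = (1 - s) * f (klein (v i)) + s * f (klein (v (i + 1))) := by
    rw [e, map_add, map_smul, map_sub, smul_eq_mul]; ring
  have e1 : f (klein (v i)) = f (klein M) := by nlinarith
  have e2 : f (klein (v (i + 1))) = f (klein M) := by nlinarith
  set p := klein (v i)
  set q := klein (v (i + 1))
  have hpq : q - p ≠ 0 := sub_ne_zero.2 fun h => hP.vertex_ne i (klein_injective h.symm)
  -- In coordinates, `f` is a multiple of `orient p q` up to a constant.
  have hfc : ∀ u : ℝ × ℝ, f u = u.1 * f (1, 0) + u.2 * f (0, 1) := by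
    intro u
    have : u = u.1 • ((1 : ℝ), (0 : ℝ)) + u.2 • ((0 : ℝ), (1 : ℝ)) := by ext <;> simp
    conv_lhs => rw [this]
    simp only [map_add, map_smul, smul_eq_mul]
  set A := f (1, 0)
  set B := f (0, 1)
  have hAB : (q.1 - p.1) * A + (q.2 - p.2) * B = 0 := by
    have h1 := hfc p
    have h2 := hfc q
    linarith
  set n2 := (q.1 - p.1) ^ 2 + (q.2 - p.2) ^ 2 with hn2
  have hn : 0 < n2 := by
    rcases (add_nonneg (sq_nonneg (q.1 - p.1)) (sq_nonneg (q.2 - p.2))).eq_or_lt with h | h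
    · exfalso
      apply hpq
      ext
      · simp only [Prod.fst_sub, Prod.fst_zero]
        nlinarith [sq_nonneg (q.1 - p.1), sq_nonneg (q.2 - p.2)]
      · simp only [Prod.snd_sub, Prod.snd_zero]
        nlinarith [sq_nonneg (q.1 - p.1), sq_nonneg (q.2 - p.2)]
    · exact h
  have key : ∀ x : ℍ, f (klein M) - f (klein x)
      = ((q.2 - p.2) * A - (q.1 - p.1) * B) / n2 * orient p q (klein x) := by
    intro x
    rw [← e1, hfc p, hfc (klein x), div_mul_eq_mul_div, eq_div_iff hn.ne', hn2]
    simp only [orient]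
    linear_combination ((q.1 - p.1) * (p.1 - (klein x).1) + (q.2 - p.2) * (p.2 - (klein x).2)) * hAB
  refine ⟨((q.2 - p.2) * A - (q.1 - p.1) * B) / n2, fun x hx => ?_, fun x hx => ?_⟩
  · rw [← key]; linarith [hle x hx]
  · rw [← key]; linarith [hf _ ⟨x, hx, rfl⟩]

/-- Near a point of a side that is not a vertex, the inner half-plane lies in the interior of the
polygon, and the line of the side contains no other points than those of the side. -/
lemma eventually_mem_interior (hP : IsConvexPolygon P v) {i : ZMod N} {z : ℍ} (hz : z ∈ side v i)
    (hzp : z ≠ v i) (hzq : z ≠ v (i + 1)) {σ : ℝ}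
    (hσ : ∀ x ∈ interior P, 0 < σ * orient (klein (v i)) (klein (v (i + 1))) (klein x)) :
    ∀ᶠ x in 𝓝 z,
      (0 < σ * orient (klein (v i)) (klein (v (i + 1))) (klein x) → x ∈ interior P) ∧
      (orient (klein (v i)) (klein (v (i + 1))) (klein x) = 0 → x ∈ side v i) := by
  obtain ⟨o, ho⟩ := hP.interior_nonempty
  have hD := hσ o ho
  set D := orient (klein (v i)) (klein (v (i + 1))) (klein o)
  have hD0 : D ≠ 0 := by rintro h; simp [h] at hD
  have h := eventually_mem_of_convex hP.convex_image ⟨_, hP.vertex_mem i, rfl⟩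
    ⟨_, hP.vertex_mem (i + 1), rfl⟩ ⟨o, interior_subset ho, rfl⟩ hD0 hz hzp hzq
  filter_upwards [eventually_eventually_nhds.2 h] with x hx
  refine ⟨fun h0 => ?_, hx.self_of_nhds.2⟩
  rw [mem_interior_iff_mem_nhds]
  have hc : ∀ᶠ y in 𝓝 x, 0 < σ * orient (klein (v i)) (klein (v (i + 1))) (klein y) :=
    (continuous_const.mul (continuous_orient _ _)).continuousAt.eventually (lt_mem_nhds h0)
  filter_upwards [hx, hc] with y hy hy0
  have h1 : 0 ≤ orient (klein (v i)) (klein (v (i + 1))) (klein y) * D := by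
    have h2 := mul_pos hy0 hD
    have h3 : 0 < σ ^ 2 := by
      have : σ ≠ 0 := by rintro h; simp [h] at hD
      positivity
    have h4 : 0 < σ ^ 2 * (orient (klein (v i)) (klein (v (i + 1))) (klein y) * D) := by
      linarith [show σ * orient (klein (v i)) (klein (v (i + 1))) (klein y) * (σ * D)
        = σ ^ 2 * (orient (klein (v i)) (klein (v (i + 1))) (klein y) * D) by ring]
    exact (pos_of_mul_pos_right h4 h3.le).le
  obtain ⟨y', hy', e⟩ := hy.1 h1
  rwa [klein_injective e] at hy'

/-- Two polygons with a common side and disjoint interiors lie on different sides of it, and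
together they are a neighbourhood of each inner point of the side. -/
lemma common_side {Q : Set ℍ} {u : ZMod N → ℍ} (hP : IsConvexPolygon P v)
    (hQ : IsConvexPolygon Q u) {i j : ZMod N} (hs : side u j = side v i)
    (hd : Disjoint (interior P) (interior Q)) {z : ℍ} (hz : z ∈ side v i) (hzp : z ≠ v i)
    (hzq : z ≠ v (i + 1)) :
    (∀ x ∈ P, ∀ y ∈ Q, orient (klein (v i)) (klein (v (i + 1))) (klein x) *
      orient (klein (v i)) (klein (v (i + 1))) (klein y) ≤ 0) ∧
    (∀ᶠ x in 𝓝 z, x ∈ P ∨ x ∈ Q) ∧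
    ∀ᶠ x in 𝓝 z, orient (klein (v i)) (klein (v (i + 1))) (klein x) ≠ 0 →
      x ∈ interior P ∨ x ∈ interior Q := by
  obtain ⟨σ, hσ1, hσ2⟩ := hP.exists_supporting i
  have hloc := hP.eventually_mem_interior hz hzp hzq hσ2
  obtain ⟨τ, hτ1, hτ2, hloc'⟩ : ∃ τ : ℝ,
      (∀ x ∈ Q, 0 ≤ τ * orient (klein (v i)) (klein (v (i + 1))) (klein x)) ∧
      (∀ x ∈ interior Q, 0 < τ * orient (klein (v i)) (klein (v (i + 1))) (klein x)) ∧
      ∀ᶠ x in 𝓝 z, 0 < τ * orient (klein (v i)) (klein (v (i + 1))) (klein x) →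
        x ∈ interior Q := by
    obtain ⟨τ, h1, h2⟩ := hQ.exists_supporting j
    rcases eq_or_eq_of_geodSegment_eq hs with ⟨ea, eb⟩ | ⟨ea, eb⟩
    · have h3 := hQ.eventually_mem_interior (i := j) (z := z) (hs ▸ hz) (ea ▸ hzp) (eb ▸ hzq) h2
      rw [ea, eb] at h1 h2 h3
      exact ⟨τ, h1, h2, h3.mono fun x hx => hx.1⟩
    · have h3 := hQ.eventually_mem_interior (i := j) (z := z) (hs ▸ hz) (ea ▸ hzq) (eb ▸ hzp) h2
      rw [ea, eb] at h1 h2 h3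
      have sw : ∀ x, τ * orient (klein (v (i + 1))) (klein (v i)) x
          = -τ * orient (klein (v i)) (klein (v (i + 1))) x := by
        intro x; rw [orient_swap]; ring
      simp only [sw] at h1 h2 h3
      exact ⟨-τ, h1, h2, h3.mono fun x hx => hx.1⟩
  have hz0 : orient (klein (v i)) (klein (v (i + 1))) (klein z) = 0 := orient_eq_zero_of_mem hz
  obtain ⟨x0, hx0, hx0'⟩ :=
    mem_closure_iff_nhds.1 (hP.subset_closure_interior (hP.side_subset i hz)) _ hloc'
  have hστ : σ * τ < 0 := by
    have h1 := hσ2 _ hx0'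
    by_contra! h
    have h2 : τ * orient (klein (v i)) (klein (v (i + 1))) (klein x0) ≤ 0 := by
      by_contra! h2
      exact Set.disjoint_left.1 hd hx0' (hx0 h2)
    set c := orient (klein (v i)) (klein (v (i + 1))) (klein x0)
    obtain ⟨o, ho⟩ := hQ.interior_nonempty
    have h3 := hτ2 o ho
    have hτ0 : τ ≠ 0 := by rintro h; simp [h] at h3
    have hσ0 : σ ≠ 0 := by rintro h; simp [h] at h1
    have hc0 : c ≠ 0 := by rintro h; simp [h] at h1
    have h5 : 0 < σ * τ := lt_of_le_of_ne h (mul_ne_zero hσ0 hτ0).symm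
    have h6 : τ * c < 0 := lt_of_le_of_ne h2 (mul_ne_zero hτ0 hc0)
    nlinarith [mul_pos h1 (neg_pos.2 h6), mul_pos h5 (mul_self_pos.2 hc0)]
  have sgn : ∀ c : ℝ, c ≠ 0 → 0 < σ * c ∨ 0 < τ * c := by
    intro c hc
    by_contra! h
    nlinarith [mul_nonneg (neg_nonneg.2 h.1) (neg_nonneg.2 h.2),
      mul_pos (neg_pos.2 hστ) (mul_self_pos.2 hc)]
  have hthird : ∀ᶠ x in 𝓝 z, orient (klein (v i)) (klein (v (i + 1))) (klein x) ≠ 0 →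
      x ∈ interior P ∨ x ∈ interior Q := by
    filter_upwards [hloc, hloc'] with x h1 h2 hx
    rcases sgn _ hx with h | h
    · exact Or.inl (h1.1 h)
    · exact Or.inr (h2 h)
  refine ⟨fun x hx y hy => ?_, ?_, hthird⟩
  · have h1 := hσ1 x hx
    have h2 := hτ1 y hy
    by_contra! h
    nlinarith [mul_nonneg h1 h2, mul_pos (neg_pos.2 hστ) h]
  · filter_upwards [hloc, hthird] with x h1 h2
    by_cases hx : orient (klein (v i)) (klein (v (i + 1))) (klein x) = 0
    · exact Or.inl (hP.side_subset i (h1.2 hx))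
    · exact (h2 hx).imp (fun h => interior_subset h) (fun h => interior_subset h)

end IsConvexPolygon

/-! ### Corners of polygons and edge-to-edge tilings -/

/-- `V` is an end point of the side number `k`. -/
def IsEnd {N : ℕ} (v : ZMod N → ℍ) (V : ℍ) (k : ZMod N) : Prop := V = v k ∨ V = v (k + 1)

lemma isEnd_of_side_eq {N : ℕ} {v u : ZMod N → ℍ} {k l : ZMod N} (h : side v k = side u l) {V : ℍ}
    (hV : IsEnd v V k) : IsEnd u V l := by
  rcases eq_or_eq_of_geodSegment_eq h with ⟨h1, h2⟩ | ⟨h1, h2⟩ <;> rcases hV with h3 | h3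
  · exact Or.inl (h3.trans h1)
  · exact Or.inr (h3.trans h2)
  · exact Or.inr (h3.trans h1)
  · exact Or.inl (h3.trans h2)

/-- The number `m` bounds from below the distances of non-adjacent sides, and the double distances
of the midpoint of a side from the adjacent sides. -/
structure SideBounds {N : ℕ} (m : ℝ) (v : ZMod N → ℍ) : Prop where
  sep : ∀ i j, i ≠ j → ¬ Adjacent i j → ∀ x ∈ side v i, ∀ y ∈ side v j, m ≤ dist x y
  mid : ∀ i j, Adjacent i j → ∀ M, IsMid M (v i) (v (i + 1)) → ∀ x ∈ side v j, m ≤ 2 * dist M x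

/-- A vertex is at least `m` away from the sides that do not end there. -/
lemma SideBounds.le_dist_vertex {N : ℕ} {m : ℝ} {v : ZMod N → ℍ} (hb : SideBounds m v)
    {i j : ZMod N} (hj : ¬ IsEnd v (v i) j) {x : ℍ} (hx : x ∈ side v j) : m ≤ dist (v i) x := by
  have h1 : j ≠ i := by rintro rfl; exact hj (Or.inl rfl)
  have h2 : j ≠ i - 1 := by rintro rfl; exact hj (Or.inr (by rw [sub_add_cancel]))
  by_cases h3 : j = i + 1
  · subst h3
    obtain ⟨M, hM⟩ := exists_isMid (v i) (v (i + 1))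
    obtain ⟨y, hy, hyd⟩ := hM.symm.exists_dist_le hx
    exact (hb.mid i (i + 1) (Or.inl rfl) M hM y hy).trans hyd
  · exact hb.sep i j h1.symm (fun h => h.elim h3 h2) _ (left_mem_geodSegment _ _) x hx

/-- The metric data of a corner at `p` with the legs `p q` and `p r`, as seen from the leg `p q`. -/
structure IsCorner (m : ℝ) (p q r : ℍ) : Prop where
  ne : p ≠ q
  inter : geodSegment p r ∩ geodSegment p q = {p}
  mid : ∀ M, IsMid M p q → ∀ x ∈ geodSegment p r, m ≤ 2 * dist M x
  far : ∀ x ∈ geodSegment p q, m ≤ dist r x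

namespace IsConvexPolygon

variable {N : ℕ} {P : Set ℍ} {v : ZMod N → ℍ} {m : ℝ}

lemma two_ne_zero (hP : IsConvexPolygon P v) : (2 : ZMod N) ≠ 0 := by
  have h3 := hP.three_le
  intro h
  have h2 : ((2 : ℕ) : ZMod N) = 0 := by exact_mod_cast h
  rw [ZMod.natCast_eq_zero_iff] at h2
  exact absurd (Nat.le_of_dvd (by norm_num) h2) (by omega)

lemma exists_corner (hP : IsConvexPolygon P v) (hb : SideBounds m v) {i j : ZMod N} (hij : i ≠ j)
    {V : ℍ} (hi : IsEnd v V i) (hj : IsEnd v V j) :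
    ∃ q r, IsCorner m V q r ∧ side v i = geodSegment V q ∧ side v j = geodSegment V r ∧
      r ∈ P := by
  have h1 := hP.one_ne_zero
  have h2 := hP.two_ne_zero
  rcases hi with rfl | rfl <;> rcases hj with e | e
  · exact absurd (hP.vertex_injective e) hij
  · obtain rfl := hP.vertex_injective e
    have es : side v j = geodSegment (v (j + 1)) (v j) := geodSegment_comm _ _
    refine ⟨v (j + 1 + 1), v j, ⟨hP.vertex_ne _, ?_, fun M hM x hx => ?_, fun x hx => ?_⟩, rfl, es,
      hP.vertex_mem _⟩
    · rw [← es]; exact hP.side_inter_next j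
    · rw [← es] at hx
      exact hb.mid (j + 1) j (Or.inr (by ring)) M hM x hx
    · refine hb.le_dist_vertex (j := j + 1) ?_ hx
      rintro (h | h)
      · exact h1 (by simpa using hP.vertex_injective h)
      · have := hP.vertex_injective h
        rw [add_assoc, one_add_one_eq_two] at this
        exact h2 (by simpa using this)
  · obtain rfl := hP.vertex_injective e
    have es : side v i = geodSegment (v (i + 1)) (v i) := geodSegment_comm _ _
    refine ⟨v i, v (i + 1 + 1), ⟨(hP.vertex_ne _).symm, ?_, fun M hM x hx => ?_, fun x hx => ?_⟩,
      es, rfl, hP.vertex_mem _⟩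
    · rw [← es, Set.inter_comm]; exact hP.side_inter_next i
    · exact hb.mid i (i + 1) (Or.inl rfl) M hM.symm x hx
    · rw [← es] at hx
      refine hb.le_dist_vertex (j := i) ?_ hx
      rintro (h | h)
      · have := hP.vertex_injective h
        rw [add_assoc, one_add_one_eq_two] at this
        exact h2 (by simpa using this)
      · exact h1 (by simpa using hP.vertex_injective h)
  · exact absurd (add_right_cancel (hP.vertex_injective e)) hij

/-- A path that passes through two neighbouring polygons, cutting a corner of the first one at the
end `V` of the common side, and then a corner of the second one at the other end `V'`, has
length at least `m`. -/
lemma le_dist_of_two_corners {Q : Set ℍ} {u : ZMod N → ℍ} (hP : IsConvexPolygon P v)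
    (hQ : IsConvexPolygon Q u) (hbP : SideBounds m v) (hbQ : SideBounds m u) {i i' j j' : ZMod N}
    (hs : side u j = side v i) (hi : i ≠ i') (hj : j ≠ j') {V V' : ℍ} (hVV : V ≠ V')
    (hVi : IsEnd v V i) (hVi' : IsEnd v V i') (hVj : IsEnd u V' j) (hVj' : IsEnd u V' j')
    (hopp : ∀ x ∈ P, ∀ y ∈ Q, orient (klein (v i)) (klein (v (i + 1))) (klein x) *
      orient (klein (v i)) (klein (v (i + 1))) (klein y) ≤ 0) {a z b : ℍ}
    (ha : a ∈ side v i') (hz : z ∈ side v i) (hb : b ∈ side u j') :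
    m ≤ dist a z + dist z b := by
  obtain ⟨q, r, hc, e1, e2, hr⟩ := hP.exists_corner hbP hi hVi hVi'
  obtain ⟨q', t, hc', e3, e4, ht⟩ := hQ.exists_corner hbQ hj hVj hVj'
  obtain ⟨rfl, rfl⟩ : V' = q ∧ q' = V := by
    rcases eq_or_eq_of_geodSegment_eq (e3.symm.trans (hs.trans e1)) with ⟨h, -⟩ | h
    · exact absurd h.symm hVV
    · exact h
  obtain ⟨M, hM⟩ := exists_isMid q' V'
  refine le_dist_add_dist_of_corners hc.ne hM (e1 ▸ hz) (e2 ▸ ha) (e4 ▸ hb) (hc.mid M hM)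
    (hc'.mid M hM.symm) hc.far ?_ hc.inter hc'.inter ?_
  · rw [geodSegment_comm]; exact hc'.far
  · have h := hopp r hr t ht
    rcases eq_or_eq_of_geodSegment_eq e1 with ⟨h1, h2⟩ | ⟨h1, h2⟩
    · rwa [h1, h2] at h
    · rw [h1, h2, orient_swap _ _ (klein r), orient_swap _ _ (klein t)] at h
      linarith

end IsConvexPolygon

/-- A locally finite edge-to-edge tiling of the hyperbolic plane by compact convex polygons with
`N` sides. -/
structure EdgeTiling (ι : Type*) (N : ℕ) where
  /-- The tiles. -/
  tile : ι → Set ℍ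
  /-- The vertices of the tiles, in cyclic order. -/
  vert : ι → ZMod N → ℍ
  polygon : ∀ i, IsConvexPolygon (tile i) (vert i)
  locallyFinite : LocallyFinite tile
  covers : ∀ z, ∃ i, z ∈ tile i
  eq_of_interior : ∀ i j, (interior (tile i) ∩ interior (tile j)).Nonempty → i = j
  neighbor : ∀ i k, ∃ j l, j ≠ i ∧ side (vert j) l = side (vert i) k

namespace EdgeTiling

variable {ι : Type*} {N : ℕ} (T : EdgeTiling ι N) {m : ℝ}

/-- `V` is a vertex of the tile number `i`. -/
def IsVertex (V : ℍ) (i : ι) : Prop := ∃ k, V = T.vert i k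

variable {T}

lemma IsVertex.of_isEnd {V : ℍ} {i : ι} {k : ZMod N} (h : IsEnd (T.vert i) V k) : T.IsVertex V i :=
  h.elim (fun h => ⟨_, h⟩) (fun h => ⟨_, h⟩)

lemma eq_of_mem_interior {i j : ι} {x : ℍ} (hi : x ∈ interior (T.tile i)) (hj : x ∈ T.tile j) :
    i = j :=
  T.eq_of_interior i j (mem_closure_iff.1 ((T.polygon j).subset_closure_interior hj) _
    isOpen_interior hi)

lemma notMem_side_of_mem_interior {i j : ι} {x : ℍ} (hi : x ∈ interior (T.tile i)) (k : ZMod N) :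
    x ∉ side (T.vert j) k := by
  intro h
  obtain rfl := T.eq_of_mem_interior hi ((T.polygon j).side_subset k h)
  exact (T.polygon i).notMem_side_of_mem_interior hi k h

/-- Exactly two tiles meet at a point of a side that is not a vertex. -/
lemma exists_other_tile {i : ι} {k : ZMod N} {z : ℍ} (hz : z ∈ side (T.vert i) k)
    (hne : ¬ T.IsVertex z i) : ∃ j l, j ≠ i ∧ side (T.vert j) l = side (T.vert i) k ∧
      (∀ n, z ∈ T.tile n → n = i ∨ n = j) ∧ (∀ᶠ x in 𝓝 z, x ∈ T.tile i ∨ x ∈ T.tile j) ∧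
      ∀ x ∈ T.tile i, ∀ y ∈ T.tile j,
        orient (klein (T.vert i k)) (klein (T.vert i (k + 1))) (klein x) *
        orient (klein (T.vert i k)) (klein (T.vert i (k + 1))) (klein y) ≤ 0 := by
  obtain ⟨j, l, hji, hs⟩ := T.neighbor i k
  have hd : Disjoint (interior (T.tile i)) (interior (T.tile j)) := by
    rw [Set.disjoint_iff_inter_eq_empty]
    by_contra h
    exact hji (T.eq_of_interior i j (Set.nonempty_iff_ne_empty.2 h)).symm
  obtain ⟨h1, h2, h3⟩ := (T.polygon i).common_side (T.polygon j) hs hd hz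
    (fun h => hne ⟨_, h⟩) (fun h => hne ⟨_, h⟩)
  refine ⟨j, l, hji, hs, fun n hn => ?_, h2, h1⟩
  obtain ⟨W, hWsub, hW, hzW⟩ := mem_nhds_iff.1 h3
  obtain ⟨σ, -, hσ⟩ := (T.polygon i).exists_supporting k
  obtain ⟨o, ho⟩ := (T.polygon i).interior_nonempty
  have ho' : orient (klein (T.vert i k)) (klein (T.vert i (k + 1))) (klein o) ≠ 0 := by
    intro h
    have := hσ o ho
    rw [h, mul_zero] at this
    exact lt_irrefl _ this
  obtain ⟨x, ⟨hxW, hxn⟩, hx0⟩ := exists_orient_ne_zero ho' (hW.inter isOpen_interior)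
    (mem_closure_iff.1 ((T.polygon n).subset_closure_interior hn) W hW hzW)
  rcases hWsub hxW hx0 with h | h
  · exact Or.inl (T.eq_of_interior n i ⟨x, hxn, h⟩)
  · exact Or.inr (T.eq_of_interior n j ⟨x, hxn, h⟩)

/-- A vertex of the tiling is a vertex of every tile that contains it. -/
lemma isVertex_of_mem {V : ℍ} {i n : ι} (hV : T.IsVertex V i) (hn : V ∈ T.tile n) :
    T.IsVertex V n := by
  obtain ⟨k, rfl⟩ := hV
  rcases (T.polygon n).mem_interior_or hn with h | ⟨l, hl⟩
  · exact absurd (left_mem_geodSegment _ _) (T.notMem_side_of_mem_interior h (j := i) k)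
  · by_contra hne
    obtain ⟨j, l', -, hs, htiles, -, -⟩ := T.exists_other_tile hl hne
    rcases htiles i ((T.polygon i).vertex_mem k) with rfl | rfl
    · exact hne ⟨k, rfl⟩
    · rw [← hs] at hl
      apply hne
      refine IsVertex.of_isEnd (isEnd_of_side_eq hs ?_)
      rcases (T.polygon i).vertex_mem_side hl with h | h
      · exact Or.inl (by rw [h])
      · exact Or.inr (by rw [h])

/-- Two sides of the tiling through a point that is not a vertex coincide. -/
lemma side_eq_of_mem {i n : ι} {k l : ZMod N} {z : ℍ} (hz : z ∈ side (T.vert i) k)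
    (hne : ¬ T.IsVertex z i) (hz' : z ∈ side (T.vert n) l) :
    side (T.vert n) l = side (T.vert i) k := by
  obtain ⟨j, l', -, hs, htiles, -, -⟩ := T.exists_other_tile hz hne
  rcases htiles n ((T.polygon n).side_subset l hz') with rfl | rfl
  · by_contra h
    have hkl : k ≠ l := by rintro rfl; exact h rfl
    exact hne ((T.polygon n).exists_vertex_of_mem_sides hkl hz hz')
  · by_contra h
    have hll : l ≠ l' := by rintro rfl; exact h hs
    rw [← hs] at hz
    exact hne (T.isVertex_of_mem ((T.polygon n).exists_vertex_of_mem_sides hll hz' hz)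
      ((T.polygon i).side_subset k (hs ▸ hz)))

lemma isClosed_iUnion_tile (p : ι → Prop) : IsClosed (⋃ i, ⋃ _ : p i, T.tile i) := by
  refine (T.locallyFinite.subset (g := fun i => ⋃ _ : p i, T.tile i) fun i => ?_).isClosed_iUnion
    fun i => ?_
  · exact Set.iUnion_subset fun _ => subset_rfl
  · by_cases h : p i
    · simpa [h] using (T.polygon i).isClosed
    · simp [h]

/-- A connected set that meets a tile with vertex `V` and a tile without it contains a point common
to two such tiles. -/
lemma exists_mem_two_tiles {S : Set ℍ} (hS : IsPreconnected S) {V x y : ℍ} {i n : ι} (hx : x ∈ S)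
    (hy : y ∈ S) (hxi : x ∈ T.tile i) (hyn : y ∈ T.tile n) (hi : T.IsVertex V i)
    (hn : ¬ T.IsVertex V n) : ∃ z ∈ S, ∃ j j', z ∈ T.tile j ∧ z ∈ T.tile j' ∧ T.IsVertex V j ∧
      ¬ T.IsVertex V j' := by
  have h := isPreconnected_closed_iff.1 hS _ _ (T.isClosed_iUnion_tile fun j => T.IsVertex V j)
    (T.isClosed_iUnion_tile fun j => ¬ T.IsVertex V j) ?_ ⟨x, hx, ?_⟩ ⟨y, hy, ?_⟩
  · obtain ⟨z, hz, h1, h2⟩ := h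
    simp only [Set.mem_iUnion] at h1 h2
    obtain ⟨j, hj, hzj⟩ := h1
    obtain ⟨j', hj', hzj'⟩ := h2
    exact ⟨z, hz, j, j', hzj, hzj', hj, hj'⟩
  · intro z _
    obtain ⟨j, hj⟩ := T.covers z
    by_cases hV : T.IsVertex V j
    · exact Or.inl (Set.mem_iUnion₂.2 ⟨j, hV, hj⟩)
    · exact Or.inr (Set.mem_iUnion₂.2 ⟨j, hV, hj⟩)
  · exact Set.mem_iUnion₂.2 ⟨i, hi, hxi⟩
  · exact Set.mem_iUnion₂.2 ⟨n, hn, hyn⟩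

/-- A point common to a tile with vertex `V` and a tile without it is on a side of the
first tile that does not end at `V`. -/
lemma exists_side_of_mem_two_tiles {V z : ℍ} {j j' : ι} (hj : z ∈ T.tile j) (hj' : z ∈ T.tile j')
    (hV : T.IsVertex V j) (hV' : ¬ T.IsVertex V j') :
    ∃ k, z ∈ side (T.vert j) k ∧ ¬ IsEnd (T.vert j) V k := by
  have hjj : j ≠ j' := by rintro rfl; exact hV' hV
  rcases (T.polygon j).mem_interior_or hj with h | ⟨l, hl⟩
  · exact absurd (T.eq_of_mem_interior h hj') hjj
  by_cases hz : T.IsVertex z j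
  · obtain ⟨k, rfl⟩ := hz
    obtain ⟨i, rfl⟩ := hV
    have hinj := (T.polygon j).vertex_injective
    have hki : k ≠ i := by
      rintro rfl
      exact hV' (T.isVertex_of_mem ⟨k, rfl⟩ hj')
    by_cases hk : i = k + 1
    · refine ⟨k - 1, ?_, ?_⟩
      · change T.vert j k ∈ geodSegment (T.vert j (k - 1)) (T.vert j (k - 1 + 1))
        rw [sub_add_cancel]
        exact right_mem_geodSegment _ _
      · rintro (h | h)
        · have := hinj h
          rw [hk] at this
          have h2 : (2 : ZMod N) = 0 := by linear_combination this
          exact (T.polygon j).two_ne_zero h2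
        · rw [sub_add_cancel] at h
          exact hki (hinj h).symm
    · refine ⟨k, left_mem_geodSegment _ _, ?_⟩
      rintro (h | h)
      · exact hki (hinj h).symm
      · exact hk (hinj h)
  · refine ⟨l, hl, fun hend => ?_⟩
    obtain ⟨n, l', -, hs, htiles, -, -⟩ := T.exists_other_tile hl hz
    rcases htiles j' hj' with rfl | rfl
    · exact hjj rfl
    · exact hV' (IsVertex.of_isEnd (isEnd_of_side_eq hs.symm hend))

/-- All tiles that come closer than `m` to a vertex contain it as a vertex. -/
lemma isVertex_of_dist_lt (hb : ∀ i, SideBounds m (T.vert i)) {V y : ℍ} {i n : ι}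
    (hV : T.IsVertex V i) (hy : y ∈ T.tile n) (hd : dist V y < m) : T.IsVertex V n := by
  by_contra hn
  have hVi : V ∈ T.tile i := by
    obtain ⟨k, rfl⟩ := hV
    exact (T.polygon i).vertex_mem k
  obtain ⟨z, hz, j, j', hj, hj', hVj, hVj'⟩ := T.exists_mem_two_tiles
    (isPreconnected_geodSegment V y) (left_mem_geodSegment V y) (right_mem_geodSegment V y) hVi hy
    hV hn
  obtain ⟨k, hk, hend⟩ := T.exists_side_of_mem_two_tiles hj hj' hVj hVj'
  obtain ⟨l, rfl⟩ := hVj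
  have h1 := (hb j).le_dist_vertex hend hk
  have h2 : dist (T.vert j l) z + dist z y = dist (T.vert j l) y := hz
  linarith [dist_nonneg (x := z) (y := y)]

end EdgeTiling

/-! ### Short paths in a tiling stay in the star of a vertex -/

namespace EdgeTiling

variable {ι : Type*} {N : ℕ} {T : EdgeTiling ι N} {m : ℝ} {x y : ℍ}

/-- A property that holds near a point of a path holds at an earlier time. -/
lemma exists_lt_geodPath {u : ℝ} (hu : u ∈ Set.Ioc (0 : ℝ) 1) {p : ℍ → Prop}
    (hp : ∀ᶠ z in 𝓝 (geodPath x y u), p z) : ∃ t ∈ Set.Ico 0 u, p (geodPath x y t) := by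
  have h1 : ∀ᶠ t in 𝓝[Set.Icc 0 1] u, p (geodPath x y t) :=
    (continuousOn_geodPath x y u (Set.Ioc_subset_Icc_self hu)).eventually hp
  have h2 : ∀ᶠ t in 𝓝[Set.Ico 0 u] u, p (geodPath x y t) :=
    h1.filter_mono (nhdsWithin_mono u fun t (ht : t ∈ Set.Ico 0 u) =>
      show t ∈ Set.Icc (0 : ℝ) 1 from ⟨ht.1, ht.2.le.trans hu.2⟩)
  have h3 : ∀ᶠ t in 𝓝[Set.Ico 0 u] u, t ∈ Set.Ico 0 u := self_mem_nhdsWithin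
  have : (𝓝[Set.Ico 0 u] u).NeBot := by
    rw [nhdsWithin_Ico_eq_nhdsLT hu.1]; infer_instance
  obtain ⟨t, h, ht⟩ := (h2.and h3).exists
  exact ⟨t, ht, h⟩

lemma geodPath_mem_tile {j : ι} {r s t : ℝ} (hr : 0 ≤ r) (ht : t ≤ 1) (hs : s ∈ Set.Icc r t)
    (h1 : geodPath x y r ∈ T.tile j) (h2 : geodPath x y t ∈ T.tile j) :
    geodPath x y s ∈ T.tile j :=
  (T.polygon j).convex _ h1 _ h2 (geodPath_mem_geodSegment x y ⟨hr, hs.1.trans (hs.2.trans ht)⟩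
    ⟨hr.trans (hs.1.trans hs.2), ht⟩ hs)

/-- The time at which the path from `x` to `y` enters a tile. -/
lemma exists_entry {j : ι} {t : ℝ} (ht : t ∈ Set.Icc (0 : ℝ) 1) (hj : geodPath x y t ∈ T.tile j) :
    ∃ s ∈ Set.Icc 0 t, geodPath x y s ∈ T.tile j ∧
      ∀ r ∈ Set.Ico 0 s, geodPath x y r ∉ T.tile j := by
  set A := Set.Icc (0 : ℝ) 1 ∩ geodPath x y ⁻¹' T.tile j
  have hA : IsClosed A :=
    (continuousOn_geodPath x y).preimage_isClosed_of_isClosed isClosed_Icc (T.polygon j).isClosed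
  have hAb : BddBelow A := ⟨0, fun r hr => hr.1.1⟩
  have hmem := hA.csInf_mem ⟨t, ht, hj⟩ hAb
  refine ⟨sInf A, ⟨hmem.1.1, csInf_le hAb ⟨ht, hj⟩⟩, hmem.2, fun r hr h => ?_⟩
  exact notMem_of_lt_csInf hr.2 hAb ⟨⟨hr.1, hr.2.le.trans hmem.1.2⟩, h⟩

/-- If the path from an inner point of a tile to `y` contains no vertex, it does not run along
a side, and thus passes the interiors of the tiles that it visits. -/
lemma geodPath_mem_interior {i₀ : ι} (hx : x ∈ interior (T.tile i₀))
    (hnv : ∀ i, ∀ W ∈ geodSegment x y, ¬ T.IsVertex W i) {j : ι} {r s t : ℝ} (hr : 0 ≤ r)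
    (ht : t ≤ 1) (hs : s ∈ Set.Ioo r t) (h1 : geodPath x y r ∈ T.tile j)
    (h2 : geodPath x y t ∈ T.tile j) : geodPath x y s ∈ interior (T.tile j) := by
  have hmem := geodPath_mem_tile hr ht (Set.Ioo_subset_Icc_self hs) h1 h2
  refine ((T.polygon j).mem_interior_or hmem).resolve_right ?_
  rintro ⟨k, hk⟩
  obtain ⟨σ, hσ1, hσ2⟩ := (T.polygon j).exists_supporting k
  set p := T.vert j k
  set q := T.vert j (k + 1)
  have hr' : r ∈ Set.Icc (0 : ℝ) 1 := ⟨hr, (hs.1.trans hs.2).le.trans ht⟩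
  have ht' : t ∈ Set.Icc (0 : ℝ) 1 := ⟨hr.trans (hs.1.trans hs.2).le, ht⟩
  have hs' : s ∈ Set.Icc (0 : ℝ) 1 := ⟨hr.trans hs.1.le, hs.2.le.trans ht⟩
  have aff : ∀ a ∈ Set.Icc (0 : ℝ) 1, orient (klein p) (klein q) (klein (geodPath x y a))
      = (1 - a) * orient (klein p) (klein q) (klein x)
        + a * orient (klein p) (klein q) (klein y) := by
    intro a ha
    rw [klein_geodPath x y ha]
    simp only [orient, AffineMap.lineMap_apply_module, Prod.fst_add, Prod.snd_add, Prod.smul_fst,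
      Prod.smul_snd, smul_eq_mul]
    ring
  have hσ0 : σ ≠ 0 := by
    rintro rfl
    obtain ⟨o, ho⟩ := (T.polygon j).interior_nonempty
    have := hσ2 o ho
    rw [zero_mul] at this
    exact lt_irrefl _ this
  have g1 := hσ1 _ h1
  have g2 := hσ1 _ h2
  have g0 : orient (klein p) (klein q) (klein (geodPath x y s)) = 0 := orient_eq_zero_of_mem hk
  rw [aff r hr'] at g1
  rw [aff t ht'] at g2
  rw [aff s hs'] at g0
  set A := orient (klein p) (klein q) (klein x) with hAdef
  set B := orient (klein p) (klein q) (klein y)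
  -- A nonnegative affine function that vanishes at an inner time is constant.
  have hA0 : A = 0 := by
    have e1 : σ * ((1 - r) * A + r * B) = σ * (B - A) * (r - s) := by
      linear_combination σ * g0
    have e2 : σ * ((1 - t) * A + t * B) = σ * (B - A) * (t - s) := by
      linear_combination σ * g0
    rw [e1] at g1
    rw [e2] at g2
    have h3 : σ * (B - A) = 0 := by
      have l1 : r - s < 0 := by linarith [hs.1]
      have l2 : 0 < t - s := by linarith [hs.2]
      nlinarith
    have h4 : B - A = 0 := (mul_eq_zero.1 h3).resolve_left hσ0
    linear_combination g0 - s * h4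
  obtain ⟨ξ, hξ⟩ := exists_smul_of_orient_eq_zero ((T.polygon j).vertex_ne k) (hAdef ▸ hA0)
  have eξ : klein x = klein p + ξ • (klein q - klein p) := by
    rw [← hξ]; exact (add_sub_cancel _ _).symm
  have hxside := T.notMem_side_of_mem_interior hx (j := j) k
  have hc := geodPath_mem_geodSegment x y (r := 0) (t := 1) (by simp) (by simp) hs'
  rw [geodPath_zero, geodPath_one] at hc
  have hsub : geodSegment x (geodPath x y s) ⊆ geodSegment x y :=
    geodSegment_subset (left_mem_geodSegment x y) hc
  obtain ⟨ζ, hζ0, hζ1, eζ⟩ := exists_combo_of_mem hk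
  rcases lt_or_ge ξ 0 with hneg | hpos
  · refine hnv j p (hsub ?_) ⟨k, rfl⟩
    have hpos : 0 < ζ - ξ := by linarith
    refine mem_of_combo (α := -ξ / (ζ - ξ)) (div_nonneg (by linarith) hpos.le) ?_ ?_
    · rw [div_le_one hpos]; linarith
    · have : klein (geodPath x y s) - klein x = (ζ - ξ) • (klein q - klein p) := by
        rw [eζ, eξ]; module
      rw [this, smul_smul, div_mul_cancel₀ _ hpos.ne', eξ]
      module
  rcases le_or_gt ξ 1 with hle | hgt
  · exact hxside (mem_of_combo hpos hle eξ)
  · refine hnv j q (hsub ?_) ⟨k + 1, rfl⟩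
    have hpos : 0 < ξ - ζ := by linarith
    refine mem_of_combo (α := (ξ - 1) / (ξ - ζ)) (div_nonneg (by linarith) hpos.le) ?_ ?_
    · rw [div_le_one hpos]; linarith
    · have : klein (geodPath x y s) - klein x = -(ξ - ζ) • (klein q - klein p) := by
        rw [eζ, eξ]; module
      rw [this, smul_smul, mul_neg, div_mul_cancel₀ _ hpos.ne', eξ]
      module

variable (T x y) in
/-- The times at which the path from `x` to `y` meets a side of the tiling that does not end at
`V`. -/
def hitTimes (V : ℍ) : Set ℝ :=
  {t ∈ Set.Icc (0 : ℝ) 1 | ∃ j k, geodPath x y t ∈ side (T.vert j) k ∧ ¬ IsEnd (T.vert j) V k}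

lemma isClosed_hitTimes (V : ℍ) : IsClosed (T.hitTimes x y V) := by
  have hc : IsClosed (⋃ j, ⋃ k, ⋃ _ : ¬ IsEnd (T.vert j) V k, side (T.vert j) k) := by
    refine (T.locallyFinite.subset
      (g := fun j => ⋃ k, ⋃ _ : ¬ IsEnd (T.vert j) V k, side (T.vert j) k) fun j => ?_
      ).isClosed_iUnion fun j => ?_
    · exact Set.iUnion_subset fun k => Set.iUnion_subset fun _ => (T.polygon j).side_subset k
    · have := (T.polygon j).neZero
      refine isClosed_iUnion_of_finite fun k => isClosed_iUnion_of_finite fun _ => ?_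
      exact isClosed_geodSegment _ _
  have h := (continuousOn_geodPath x y).preimage_isClosed_of_isClosed isClosed_Icc hc
  convert h using 1
  ext t
  simp [hitTimes]
  grind

/-- As long as the path avoids the sides that do not end at `V`, it only visits tiles with the
vertex `V`. -/
lemma isVertex_of_forall_notMem_hitTimes {V : ℍ} {i₀ n : ι} (hx : x ∈ T.tile i₀)
    (hV : T.IsVertex V i₀) {t : ℝ} (ht : t ∈ Set.Icc (0 : ℝ) 1)
    (hH : ∀ s ∈ Set.Icc 0 t, s ∉ T.hitTimes x y V) (hn : geodPath x y t ∈ T.tile n) :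
    T.IsVertex V n := by
  by_contra hVn
  have hpre : IsPreconnected (geodPath x y '' Set.Icc 0 t) :=
    isPreconnected_Icc.image _ ((continuousOn_geodPath x y).mono (Set.Icc_subset_Icc_right ht.2))
  obtain ⟨z, ⟨s, hs, rfl⟩, j, j', hj, hj', hVj, hVj'⟩ := T.exists_mem_two_tiles hpre
    ⟨0, ⟨le_rfl, ht.1⟩, rfl⟩ ⟨t, ⟨ht.1, le_rfl⟩, rfl⟩ (by rwa [geodPath_zero]) hn hV hVn
  obtain ⟨k, hk, hend⟩ := T.exists_side_of_mem_two_tiles hj hj' hVj hVj'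
  exact hH s hs ⟨⟨hs.1, hs.2.trans ht.2⟩, j, k, hk, hend⟩

/-- If the path from an inner point of the tile `i₀` to a point of the tile `n` is shorter than `m`,
the two tiles have a common vertex: one follows the path until it has left, as late as possible, the
star of a vertex of `i₀`, and looks at the last two tiles that it has crossed. -/
theorem exists_common_vertex_of_mem_interior (hb : ∀ i, SideBounds m (T.vert i)) {i₀ n : ι}
    (hx : x ∈ interior (T.tile i₀)) (hy : y ∈ T.tile n) (hd : dist x y < m) :
    ∃ V, T.IsVertex V i₀ ∧ T.IsVertex V n := by
  by_contra! hno
  have hx' : x ∈ T.tile i₀ := interior_subset hx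
  have hnv : ∀ i, ∀ W ∈ geodSegment x y, ¬ T.IsVertex W i := by
    intro i W hW hWi
    have h1 : dist x W + dist W y = dist x y := hW
    refine hno W (T.isVertex_of_dist_lt hb hWi hx' ?_) (T.isVertex_of_dist_lt hb hWi hy ?_)
    · rw [dist_comm]; linarith [dist_nonneg (x := W) (y := y)]
    · linarith [dist_nonneg (x := x) (y := W)]
  have hnv' : ∀ t ∈ Set.Icc (0 : ℝ) 1, ∀ i, ¬ T.IsVertex (geodPath x y t) i := by
    intro t ht i
    have := geodPath_mem_geodSegment x y (r := 0) (t := 1) (by simp) (by simp) ht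
    rw [geodPath_zero, geodPath_one] at this
    exact hnv i _ this
  have hlen : ∀ r s, 0 ≤ r → r ≤ s → s ≤ 1 → dist (geodPath x y r) (geodPath x y s) < m := by
    intro r s h0 hrs h1
    have := dist_geodPath_add x y h0 hrs h1
    linarith [dist_nonneg (x := x) (y := geodPath x y r),
      dist_nonneg (x := geodPath x y s) (y := y)]
  have hneH : ∀ k, (T.hitTimes x y (T.vert i₀ k)).Nonempty := by
    intro k
    by_contra hempty
    rw [Set.not_nonempty_iff_eq_empty] at hempty
    refine hno _ ⟨k, rfl⟩ (T.isVertex_of_forall_notMem_hitTimes (y := y) hx' ⟨k, rfl⟩ (t := 1)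
      (by simp) ?_ (by rwa [geodPath_one]))
    simp [hempty]
  have hbdd : ∀ V, BddBelow (T.hitTimes x y V) := fun V => ⟨0, fun t ht => ht.1.1⟩
  have := (T.polygon i₀).neZero
  obtain ⟨k₀, hmax⟩ := Finite.exists_max fun k => sInf (T.hitTimes x y (T.vert i₀ k))
  set V := T.vert i₀ k₀ with hVdef
  set u := sInf (T.hitTimes x y V) with hu
  have hVi₀ : T.IsVertex V i₀ := ⟨k₀, rfl⟩
  -- It suffices to find a vertex of `i₀` whose star the path leaves later.
  have hcontra : ∀ V', T.IsVertex V' i₀ →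
      ¬ ∀ t ∈ Set.Icc 0 u, ∀ j k, geodPath x y t ∈ side (T.vert j) k → IsEnd (T.vert j) V' k := by
    rintro _ ⟨k, rfl⟩ h
    obtain ⟨ht, j, l, hjl, hend⟩ := (isClosed_hitTimes _).csInf_mem (hneH k) (hbdd _)
    exact hend (h _ ⟨ht.1, hmax k⟩ j l hjl)
  obtain ⟨⟨hu0, hu1⟩, j₁, l₁, hzs, hVend⟩ : u ∈ T.hitTimes x y V :=
    (isClosed_hitTimes _).csInf_mem (hneH k₀) (hbdd _)
  have hbefore : ∀ t, 0 ≤ t → t < u → ∀ j k, geodPath x y t ∈ side (T.vert j) k →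
      IsEnd (T.vert j) V k := by
    intro t h0 htu j k hjk
    by_contra hend
    exact notMem_of_lt_csInf htu (hbdd V) ⟨⟨h0, htu.le.trans hu1⟩, j, k, hjk, hend⟩
  have hupos : 0 < u := by
    refine hu0.lt_of_ne fun h => ?_
    rw [← h, geodPath_zero] at hzs
    exact T.notMem_side_of_mem_interior hx l₁ hzs
  -- The tile `Q` from which the path meets that side.
  obtain ⟨j₂, l₂, -, hs12, -, hcov, -⟩ := T.exists_other_tile hzs (hnv' u ⟨hu0, hu1⟩ _)
  obtain ⟨Q, e, t₁, ht₁, hQt₁, hzQ, hQend⟩ : ∃ Q e, ∃ t₁ ∈ Set.Ico 0 u,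
      geodPath x y t₁ ∈ T.tile Q ∧ geodPath x y u ∈ side (T.vert Q) e ∧
      ¬ IsEnd (T.vert Q) V e := by
    obtain ⟨t, ht, h | h⟩ := exists_lt_geodPath ⟨hupos, hu1⟩ hcov
    · exact ⟨j₁, l₁, t, ht, h, hzs, hVend⟩
    · exact ⟨j₂, l₂, t, ht, h, hs12 ▸ hzs, fun h => hVend (isEnd_of_side_eq hs12 h)⟩
  have hzQ' : geodPath x y u ∈ T.tile Q := (T.polygon Q).side_subset e hzQ
  have hend_u : ∀ {V'}, IsEnd (T.vert Q) V' e → ∀ j k, geodPath x y u ∈ side (T.vert j) k →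
      IsEnd (T.vert j) V' k := fun hV' j k hjk =>
    isEnd_of_side_eq (T.side_eq_of_mem hzQ (hnv' u ⟨hu0, hu1⟩ _) hjk).symm hV'
  obtain ⟨u', ⟨hu'0, hu't⟩, hQu', hentry⟩ :=
    exists_entry (T := T) (x := x) (y := y) ⟨ht₁.1, ht₁.2.le.trans hu1⟩ hQt₁
  have hu'u : u' < u := hu't.trans_lt ht₁.2
  have hu'1 : u' ≤ 1 := hu'u.le.trans hu1
  rcases hu'0.eq_or_lt with h0 | hu'pos
  · -- The path starts in `Q`.
    subst h0
    rw [geodPath_zero] at hQu'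
    obtain rfl := T.eq_of_mem_interior hx hQu'
    refine hcontra (T.vert i₀ e) ⟨e, rfl⟩ fun t ht j k hjk => ?_
    rcases ht.1.eq_or_lt with h0 | h0
    · rw [← h0, geodPath_zero] at hjk
      exact absurd hjk (T.notMem_side_of_mem_interior hx k)
    rcases ht.2.eq_or_lt with htu | htu
    · rw [htu] at hjk
      exact hend_u (Or.inl rfl) j k hjk
    · exact absurd hjk (T.notMem_side_of_mem_interior (geodPath_mem_interior hx hnv le_rfl hu1
        ⟨h0, htu⟩ (by rwa [geodPath_zero]) hzQ') k)
  -- The path enters `Q` through the side `f`.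
  obtain ⟨f, hf⟩ : ∃ f, geodPath x y u' ∈ side (T.vert Q) f := by
    refine ((T.polygon Q).mem_interior_or hQu').resolve_left fun h => ?_
    obtain ⟨t, ht, h⟩ := exists_lt_geodPath ⟨hu'pos, hu'1⟩
      (p := fun z => z ∈ T.tile Q) (mem_interior_iff_mem_nhds.1 h)
    exact hentry t ht h
  have hVf : IsEnd (T.vert Q) V f := hbefore u' hu'0 hu'u Q f hf
  have hfe : f ≠ e := by rintro rfl; exact hQend hVf
  have hadj : Adjacent f e := by
    by_contra hadj
    exact absurd ((hb Q).sep f e hfe hadj _ hf _ hzQ) (not_le.2 (hlen u' u hu'0 hu'u.le hu1))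
  obtain ⟨V', hV'f, hV'e⟩ : ∃ V', IsEnd (T.vert Q) V' f ∧ IsEnd (T.vert Q) V' e := by
    rcases hadj with rfl | rfl
    · exact ⟨_, Or.inr rfl, Or.inl rfl⟩
    · exact ⟨_, Or.inl rfl, Or.inr (by rw [sub_add_cancel])⟩
  have hVV' : V ≠ V' := by rintro h; rw [← h] at hV'e; exact hQend hV'e
  have hend_u' : ∀ {W}, IsEnd (T.vert Q) W f → ∀ j k, geodPath x y u' ∈ side (T.vert j) k →
      IsEnd (T.vert j) W k := fun hW j k hjk =>
    isEnd_of_side_eq (T.side_eq_of_mem hf (hnv' u' ⟨hu'0, hu'1⟩ _) hjk).symm hW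
  -- The tile `R` on the other side of `f`.
  obtain ⟨R, g, -, hsR, -, hcovR, hopp⟩ := T.exists_other_tile hf (hnv' u' ⟨hu'0, hu'1⟩ _)
  have hu'R : geodPath x y u' ∈ side (T.vert R) g := hsR ▸ hf
  have hu'R' : geodPath x y u' ∈ T.tile R := (T.polygon R).side_subset g hu'R
  obtain ⟨t₂, ht₂, hRt₂⟩ : ∃ t₂ ∈ Set.Ico 0 u', geodPath x y t₂ ∈ T.tile R := by
    obtain ⟨t, ht, h | h⟩ := exists_lt_geodPath ⟨hu'pos, hu'1⟩ hcovR
    · exact absurd h (hentry t ht)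
    · exact ⟨t, ht, h⟩
  obtain ⟨u'', ⟨hu''0, hu''t⟩, hRu'', hentryR⟩ :=
    exists_entry (T := T) (x := x) (y := y) ⟨ht₂.1, ht₂.2.le.trans hu'1⟩ hRt₂
  have hu''u' : u'' < u' := hu''t.trans_lt ht₂.2
  have hRint : ∀ s ∈ Set.Ioo u'' u', geodPath x y s ∈ interior (T.tile R) := fun s hs =>
    geodPath_mem_interior hx hnv hu''0 hu'1 hs hRu'' hu'R'
  rcases (T.polygon R).mem_interior_or hRu'' with hint | ⟨f', hf'⟩
  · -- The path starts in `R`, and the star of `V'` contains it longer than that of `V`.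
    have h0 : u'' = 0 := by
      by_contra h0
      obtain ⟨t, ht, h⟩ := exists_lt_geodPath ⟨lt_of_le_of_ne hu''0 (Ne.symm h0),
        hu''u'.le.trans hu'1⟩ (p := fun z => z ∈ T.tile R) (mem_interior_iff_mem_nhds.1 hint)
      exact hentryR t ht h
    have hxR : x ∈ T.tile R := by rwa [h0, geodPath_zero] at hRu''
    obtain rfl := T.eq_of_mem_interior hx hxR
    refine hcontra V' (IsVertex.of_isEnd (isEnd_of_side_eq hsR.symm hV'f)) fun t ht j k hjk => ?_
    rcases ht.1.eq_or_lt with h | h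
    · rw [← h, geodPath_zero] at hjk
      exact absurd hjk (T.notMem_side_of_mem_interior hx k)
    rcases lt_trichotomy t u' with h' | h' | h'
    · exact absurd hjk (T.notMem_side_of_mem_interior (hRint t ⟨h0 ▸ h, h'⟩) k)
    · rw [h'] at hjk
      exact hend_u' hV'f j k hjk
    rcases ht.2.eq_or_lt with htu | htu
    · rw [htu] at hjk
      exact hend_u hV'e j k hjk
    · exact absurd hjk (T.notMem_side_of_mem_interior (geodPath_mem_interior hx hnv hu'0 hu1
        ⟨h', htu⟩ hQu' hzQ') k)
  · -- The path cuts the corner of `R` at `V` and that of `Q` at `V'`.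
    have hVf' : IsEnd (T.vert R) V f' := hbefore u'' hu''0 (hu''u'.trans hu'u) R f' hf'
    have hgf' : g ≠ f' := by
      rintro rfl
      obtain ⟨s, hs⟩ := exists_between hu''u'
      have h1 := geodSegment_subset hf' hu'R (geodPath_mem_geodSegment x y
        ⟨hu''0, hu''u'.le.trans hu'1⟩ ⟨hu'0, hu'1⟩ (Set.Ioo_subset_Icc_self hs))
      exact T.notMem_side_of_mem_interior (hRint s hs) (j := R) g h1
    have hopp' : ∀ a ∈ T.tile R, ∀ b ∈ T.tile Q,
        orient (klein (T.vert R g)) (klein (T.vert R (g + 1))) (klein a) *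
        orient (klein (T.vert R g)) (klein (T.vert R (g + 1))) (klein b) ≤ 0 := by
      intro a ha b hb'
      have h := hopp b hb' a ha
      rw [mul_comm]
      rcases eq_or_eq_of_geodSegment_eq hsR with ⟨h1, h2⟩ | ⟨h1, h2⟩
      · rwa [h1, h2]
      · rw [h1, h2, orient_swap, orient_swap _ _ (klein a), neg_mul_neg]
        exact h
    have hlow := (T.polygon R).le_dist_of_two_corners (T.polygon Q) (hb R) (hb Q) hsR.symm hgf' hfe
      hVV' (isEnd_of_side_eq hsR.symm hVf) hVf' hV'f hV'e hopp' hf' hu'R hzQ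
    have hadd : dist (geodPath x y u'') (geodPath x y u') + dist (geodPath x y u') (geodPath x y u)
        = dist (geodPath x y u'') (geodPath x y u) :=
      geodPath_mem_geodSegment x y ⟨hu''0, hu''u'.le.trans hu'1⟩ ⟨hu0, hu1⟩ ⟨hu''u'.le, hu'u.le⟩
    linarith [hlen u'' u hu''0 (hu''u'.trans hu'u).le hu1]

/-- Tiles without a common vertex are at least `m` apart. -/
theorem exists_common_vertex (hb : ∀ i, SideBounds m (T.vert i)) {i n : ι}
    (hx : x ∈ T.tile i) (hy : y ∈ T.tile n) (hd : dist x y < m) :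
    ∃ V, T.IsVertex V i ∧ T.IsVertex V n := by
  have hopen : IsOpen {z : ℍ | dist z y < m} := isOpen_lt (by fun_prop) (by fun_prop)
  obtain ⟨x', hx'd, hx'⟩ :=
    mem_closure_iff.1 ((T.polygon i).subset_closure_interior hx) _ hopen hd
  exact T.exists_common_vertex_of_mem_interior hb hx' hy hx'd

end EdgeTiling

/-! ### The tiling by a fundamental polygon and its shells -/

lemma smul_geodSegment (γ : SL(2, ℝ)) (z w : ℍ) :
    γ • geodSegment z w = geodSegment (γ • z) (γ • w) := by
  ext x
  rw [Set.mem_smul_set_iff_inv_smul_mem]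
  simp only [geodSegment, Set.mem_ofPred_eq]
  rw [← dist_smul γ z, ← dist_smul γ _ w, ← dist_smul γ z w, smul_inv_smul]

lemma smul_side {N : ℕ} (γ : SL(2, ℝ)) (v : ZMod N → ℍ) (i : ZMod N) :
    γ • side v i = side (fun k => γ • v k) i := smul_geodSegment γ _ _

lemma IsConvexPolygon.smul {N : ℕ} {P : Set ℍ} {v : ZMod N → ℍ} (hP : IsConvexPolygon P v)
    (γ : SL(2, ℝ)) : IsConvexPolygon (γ • P) fun k => γ • v k where
  three_le := hP.three_le
  isCompact := hP.isCompact.smul γ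
  interior_nonempty := by rw [interior_smul]; exact hP.interior_nonempty.smul_set
  convex := by
    rintro _ ⟨x, hx, rfl⟩ _ ⟨y, hy, rfl⟩
    change geodSegment (γ • x) (γ • y) ⊆ γ • P
    rw [← smul_geodSegment]
    exact Set.smul_set_mono (hP.convex x hx y hy)
  frontier_eq := by
    have h : frontier (γ • P) = γ • frontier P := ((Homeomorph.smul γ).image_frontier P).symm
    rw [h, hP.frontier_eq, Set.smul_set_iUnion]
    exact Set.iUnion_congr fun i => smul_side γ v i
  vertex_injective := (MulAction.injective γ).comp hP.vertex_injective
  side_inter_next i := by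
    rw [← smul_side, ← smul_side, ← Set.smul_set_inter, hP.side_inter_next, Set.smul_set_singleton]
  side_disjoint i j hij hadj := by
    rw [← smul_side, ← smul_side]
    exact (Set.disjoint_smul_set).2 (hP.side_disjoint i j hij hadj)

lemma SideBounds.smul {N : ℕ} {m : ℝ} {v : ZMod N → ℍ} (hb : SideBounds m v) (γ : SL(2, ℝ)) :
    SideBounds m fun k => γ • v k where
  sep i j hij hadj := by
    rw [← smul_side, ← smul_side]
    rintro _ ⟨x, hx, rfl⟩ _ ⟨y, hy, rfl⟩
    change m ≤ dist (γ • x) (γ • y)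
    rw [dist_smul]
    exact hb.sep i j hij hadj x hx y hy
  mid i j hadj M hM := by
    rw [← smul_side]
    rintro _ ⟨x, hx, rfl⟩
    change m ≤ 2 * dist M (γ • x)
    rw [← smul_inv_smul γ M, dist_smul]
    refine hb.mid i j hadj _ ?_ x hx
    obtain ⟨h1, h2⟩ := hM
    rw [← smul_inv_smul γ M, dist_smul, dist_smul] at h1 h2
    exact ⟨h1, h2⟩

lemma setDist_le {A B : Set ℍ} {x y : ℍ} (hx : x ∈ A) (hy : y ∈ B) : setDist A B ≤ dist x y :=
  csInf_le ⟨0, by rintro _ ⟨a, -, b, -, rfl⟩; exact dist_nonneg⟩ ⟨x, hx, y, hy, rfl⟩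

lemma le_setDist {A B : Set ℍ} {d : ℝ} (hA : A.Nonempty) (hB : B.Nonempty)
    (h : ∀ x ∈ A, ∀ y ∈ B, d ≤ dist x y) : d ≤ setDist A B := by
  obtain ⟨a, ha⟩ := hA
  obtain ⟨b, hb⟩ := hB
  refine le_csInf ⟨_, a, ha, b, hb, rfl⟩ ?_
  rintro _ ⟨x, hx, y, hy, rfl⟩
  exact h x hx y hy

lemma sideBounds_of_le {N : ℕ} {m : ℝ} {v : ZMod N → ℍ}
    (h1 : ∀ i j, i ≠ j → ¬ Adjacent i j → m ≤ delta v i j) (h2 : ∀ k, m ≤ 2 * epsilon v k) :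
    SideBounds m v where
  sep i j hij hadj _ hx _ hy := (h1 i j hij hadj).trans (setDist_le hx hy)
  mid i j hadj M hM x hx := by
    have hx' : x ∈ side v (i - 1) ∪ side v (i + 1) := by
      rcases hadj with rfl | rfl
      · exact Or.inr hx
      · exact Or.inl hx
    have : epsilon v i ≤ dist M x := setDist_le (show M ∈ sideMidpoint v i from hM) hx'
    linarith [h2 i]

/-- A connected set that meets `A` and contains a point outside the interior of `A` meets the
boundary of `A`. -/
lemma inter_frontier_nonempty {S A : Set ℍ} (hS : IsPreconnected S) {x y : ℍ} (hx : x ∈ S)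
    (hy : y ∈ S) (hxA : x ∈ A) (hyA : y ∉ interior A) : (S ∩ frontier A).Nonempty := by
  by_contra hne
  have hfr : ∀ z ∈ S, z ∈ closure A → z ∈ interior A := by
    intro z hz hc
    by_contra hi
    exact hne ⟨z, hz, hc, hi⟩
  obtain ⟨z, -, h1, h2⟩ := hS (interior A) (closure A)ᶜ isOpen_interior
    isClosed_closure.isOpen_compl
    (fun z hz => by
      by_cases hc : z ∈ closure A
      · exact Or.inl (hfr z hz hc)
      · exact Or.inr hc)
    ⟨x, hx, hfr x hx (subset_closure hxA)⟩ ⟨y, hy, fun hc => hyA (hfr y hy hc)⟩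
  exact h2 (subset_closure (interior_subset h1))

lemma dist_le_of_mem_geodSegment {x y z w : ℍ} (hz : z ∈ geodSegment x y)
    (hw : w ∈ geodSegment x y) : dist z w ≤ dist x y := by
  have h1 : dist x z + dist z y = dist x y := hz
  have h2 : dist x w + dist w y = dist x y := hw
  have h3 := dist_triangle_left z w x
  have h4 := dist_triangle_right z w y
  linarith

namespace IsFundamentalPolygon

variable {N : ℕ} {Γ : Subgroup SL(2, ℝ)} {P : Set ℍ} {v : ZMod N → ℍ}

lemma smul_eq_smul (hP : IsFundamentalPolygon Γ P v) {γ γ' : SL(2, ℝ)} (h : γ ∈ Γ) (h' : γ' ∈ Γ)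
    {x : ℍ} (hx : x ∈ γ • interior P) (hx' : x ∈ γ' • interior P) (z : ℍ) : γ • z = γ' • z := by
  have hne : (interior P ∩ (γ⁻¹ * γ') • interior P).Nonempty := by
    refine ⟨γ⁻¹ • x, Set.mem_smul_set_iff_inv_smul_mem.1 hx, ?_⟩
    rw [mul_smul]
    exact Set.smul_mem_smul_set hx'
  have := hP.interiors_disjoint _ (Γ.mul_mem (Γ.inv_mem h) h') hne z
  rw [mul_smul, inv_smul_eq_iff] at this
  exact this.symm

variable {p₀ : ℍ}

/-- An element of `Γ` that maps the base point to a given point of its orbit. -/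
noncomputable def rep (o : MulAction.orbit Γ p₀) : SL(2, ℝ) := (Classical.choose o.2 : Γ)

lemma rep_mem (o : MulAction.orbit Γ p₀) : rep o ∈ Γ := (Classical.choose o.2 : Γ).2

lemma rep_smul (o : MulAction.orbit Γ p₀) : rep o • p₀ = o := Classical.choose_spec o.2

/-- The orbit point to which `γ` maps the base point. -/
noncomputable def orbitPoint (p₀ : ℍ) {γ : SL(2, ℝ)} (h : γ ∈ Γ) : MulAction.orbit Γ p₀ :=
  ⟨γ • p₀, ⟨⟨γ, h⟩, rfl⟩⟩

lemma rep_orbitPoint_smul (hP : IsFundamentalPolygon Γ P v) (hp : p₀ ∈ interior P) {γ : SL(2, ℝ)}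
    (h : γ ∈ Γ) (z : ℍ) : rep (orbitPoint p₀ h) • z = γ • z :=
  hP.smul_eq_smul (rep_mem _) h (x := γ • p₀)
    (by rw [show γ • p₀ = _ from (rep_smul (orbitPoint p₀ h)).symm]
        exact Set.smul_mem_smul_set hp) (Set.smul_mem_smul_set hp) z

lemma rep_orbitPoint_smul_set (hP : IsFundamentalPolygon Γ P v) (hp : p₀ ∈ interior P)
    {γ : SL(2, ℝ)} (h : γ ∈ Γ) (A : Set ℍ) : rep (orbitPoint p₀ h) • A = γ • A :=
  Set.image_congr fun z _ => hP.rep_orbitPoint_smul hp h z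

/-- A bounded part of an orbit of a Fuchsian group is finite. -/
lemma finite_orbit_inter (hΓ : IsFuchsian Γ) (p z : ℍ) (r : ℝ) :
    (MulAction.orbit Γ p ∩ Metric.closedBall z r).Finite := by
  by_contra h
  obtain ⟨w, -, hw⟩ := Set.Infinite.exists_accPt_of_subset_isCompact h (isCompact_closedBall z r)
    Set.inter_subset_right
  exact hΓ p w (hw.mono (principal_mono.2 Set.inter_subset_left))

lemma exists_dist_le (hP : IsFundamentalPolygon Γ P v) (p₀ : ℍ) :
    ∃ R, ∀ x ∈ P, dist x p₀ ≤ R := by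
  obtain ⟨R, hR⟩ := (Metric.isBounded_iff_subset_closedBall p₀).1 hP.polygon.isCompact.isBounded
  exact ⟨R, fun x hx => hR hx⟩

/-- The tiling by the images of a fundamental polygon. As elements of `Γ` may act trivially, the
tiles are indexed by the orbit of a point `p₀` in the interior of the polygon. -/
noncomputable def tiling (hΓ : IsFuchsian Γ) (hP : IsFundamentalPolygon Γ P v)
    (hp : p₀ ∈ interior P) : EdgeTiling (MulAction.orbit Γ p₀) N where
  tile o := rep o • P
  vert o k := rep o • v k
  polygon o := hP.polygon.smul (rep o)
  locallyFinite z := by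
    obtain ⟨R, hR⟩ := hP.exists_dist_le p₀
    refine ⟨Metric.ball z 1, Metric.ball_mem_nhds z one_pos, ?_⟩
    refine ((finite_orbit_inter hΓ p₀ z (R + 1)).preimage
      (f := ((↑) : MulAction.orbit Γ p₀ → ℍ)) Subtype.val_injective.injOn).subset ?_
    rintro o ⟨_, ⟨x, hx, rfl⟩, hx'⟩
    refine ⟨o.2, ?_⟩
    have h1 : dist (rep o • x) z < 1 := hx'
    have h2 := hR x hx
    rw [← dist_smul (rep o), rep_smul] at h2
    have := dist_triangle_left (o : ℍ) z (rep o • x)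
    rw [Metric.mem_closedBall]
    linarith
  covers z := by
    obtain ⟨γ, hγ, hz⟩ := hP.covers z
    exact ⟨orbitPoint p₀ hγ, by rwa [hP.rep_orbitPoint_smul_set hp]⟩
  eq_of_interior o o' h := by
    obtain ⟨x, h1, h2⟩ := h
    rw [interior_smul] at h1 h2
    have := hP.smul_eq_smul (rep_mem o) (rep_mem o') h1 h2 p₀
    rw [rep_smul, rep_smul] at this
    exact Subtype.ext this
  neighbor o k := by
    obtain ⟨γ, hγ, j, hs, hne⟩ := hP.side_pairing k
    have hmem := Γ.mul_mem (rep_mem o) hγ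
    refine ⟨orbitPoint p₀ hmem, j, ?_, ?_⟩
    · intro h
      apply hne
      have h1 := hP.rep_orbitPoint_smul_set hp hmem P
      rw [h, mul_smul] at h1
      exact (MulAction.injective (rep o) h1).symm
    · rw [← smul_side, ← smul_side, hP.rep_orbitPoint_smul_set hp, mul_smul, hs]

/-- Unions of images of the polygon are closed. -/
lemma isClosed_biUnion_smul (hΓ : IsFuchsian Γ) (hP : IsFundamentalPolygon Γ P v)
    {A : Set SL(2, ℝ)} (hA : A ⊆ Γ) : IsClosed (⋃ γ ∈ A, γ • P) := by
  obtain ⟨p₀, hp⟩ := hP.polygon.interior_nonempty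
  convert (hP.tiling hΓ hp).isClosed_iUnion_tile (fun o => ∃ γ ∈ A, γ • p₀ = o) using 1
  ext z
  simp only [Set.mem_iUnion, exists_prop]
  constructor
  · rintro ⟨γ, hγ, hz⟩
    exact ⟨orbitPoint p₀ (hA hγ), ⟨γ, hγ, rfl⟩,
      show z ∈ rep _ • P by rwa [hP.rep_orbitPoint_smul_set hp]⟩
  · rintro ⟨o, ⟨γ, hγ, e⟩, hz⟩
    obtain rfl : orbitPoint p₀ (hA hγ) = o := Subtype.ext e
    have hz' : z ∈ rep (orbitPoint p₀ (hA hγ)) • P := hz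
    exact ⟨γ, hγ, by rwa [hP.rep_orbitPoint_smul_set hp] at hz'⟩

lemma one_mem_neighborSet : 1 ∈ neighborSet Γ P v := ⟨Γ.one_mem, Or.inl (one_smul _ _)⟩

lemma neighborSet_pow_subset (n : ℕ) : neighborSet Γ P v ^ n ⊆ Γ := by
  induction n with
  | zero => simp [Γ.one_mem]
  | succ n ih =>
    rw [pow_succ]
    rintro _ ⟨γ, hγ, τ, hτ, rfl⟩
    exact Γ.mul_mem (ih hγ) hτ.1

lemma shellRegion_zero : shellRegion Γ P v 0 = P := by simp [shellRegion]

lemma shellRegion_one : shellRegion Γ P v 1 = ⋃ γ ∈ neighborSet Γ P v, γ • P := by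
  simp [shellRegion]

lemma isClosed_shellRegion (hΓ : IsFuchsian Γ) (hP : IsFundamentalPolygon Γ P v) (n : ℕ) :
    IsClosed (shellRegion Γ P v n) := hP.isClosed_biUnion_smul hΓ (neighborSet_pow_subset n)

lemma exists_smul_mem (hP : IsFundamentalPolygon Γ P v) {τ : SL(2, ℝ)}
    (hτ : τ ∈ neighborSet Γ P v) : ∃ x ∈ P, τ • x ∈ P := by
  rcases hτ.2 with h | ⟨i, j, h⟩ | ⟨i, j, h⟩
  · have hv := hP.polygon.vertex_mem 0
    exact ⟨v 0, hv, h ▸ Set.smul_mem_smul_set hv⟩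
  · refine ⟨v j, hP.polygon.vertex_mem j, hP.polygon.side_subset i ?_⟩
    rw [← h]
    exact Set.smul_mem_smul_set (left_mem_geodSegment _ _)
  · exact ⟨v j, hP.polygon.vertex_mem j, h ▸ hP.polygon.vertex_mem i⟩

lemma exists_shellRegion_subset (hP : IsFundamentalPolygon Γ P v) (p₀ : ℍ) (n : ℕ) :
    ∃ R, shellRegion Γ P v n ⊆ Metric.closedBall p₀ R := by
  obtain ⟨R, hR⟩ := hP.exists_dist_le p₀
  have hstep : ∀ n, ∃ C, ∀ γ ∈ neighborSet Γ P v ^ n, dist (γ • p₀) p₀ ≤ C := by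
    intro n
    induction n with
    | zero => exact ⟨0, by simp⟩
    | succ n ih =>
      obtain ⟨C, hC⟩ := ih
      refine ⟨C + 2 * R, ?_⟩
      rw [pow_succ]
      rintro _ ⟨γ, hγ, τ, hτ, rfl⟩
      change dist ((γ * τ) • p₀) p₀ ≤ _
      obtain ⟨x, hx, hx'⟩ := hP.exists_smul_mem hτ
      have h1 := hR x hx
      have h2 := hR _ hx'
      rw [← dist_smul τ] at h1
      have h3 := dist_triangle_left (τ • p₀) p₀ (τ • x)
      rw [← dist_smul γ, ← mul_smul] at h3
      have h4 := dist_triangle ((γ * τ) • p₀) (γ • p₀) p₀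
      linarith [hC γ hγ]
  obtain ⟨C, hC⟩ := hstep n
  refine ⟨R + C, Set.iUnion₂_subset fun γ hγ => ?_⟩
  rintro _ ⟨x, hx, rfl⟩
  change dist (γ • x) p₀ ≤ R + C
  have h1 := hR x hx
  rw [← dist_smul γ] at h1
  linarith [hC γ hγ, dist_triangle (γ • x) (γ • p₀) p₀]

lemma frontier_shellRegion_nonempty (hP : IsFundamentalPolygon Γ P v) (n : ℕ) :
    (frontier (shellRegion Γ P v n)).Nonempty := by
  obtain ⟨R, hR⟩ := hP.exists_shellRegion_subset (v 0) n
  rw [nonempty_frontier_iff]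
  constructor
  · have h1 : (1 : SL(2, ℝ)) ∈ neighborSet Γ P v ^ n := by
      simpa using Set.pow_mem_pow (n := n) (one_mem_neighborSet (Γ := Γ) (P := P) (v := v))
    exact ⟨v 0, Set.mem_iUnion₂.2 ⟨1, h1, by simpa using hP.polygon.vertex_mem 0⟩⟩
  · intro h
    rw [h] at hR
    exact noncompact_univ ℍ ((isCompact_closedBall (v 0) R).of_isClosed_subset isClosed_univ hR)

/-- Every crossing distance is at least the first one: a path from a tile `γ P` of the `n`-th shell
region to the boundary of the next one leaves `γ P` and `γ T (P)`. -/
lemma crossingDist_zero_le (hΓ : IsFuchsian Γ) (hP : IsFundamentalPolygon Γ P v) (n : ℕ) :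
    crossingDist Γ P v 0 ≤ crossingDist Γ P v n := by
  refine le_setDist (hP.frontier_shellRegion_nonempty n) (hP.frontier_shellRegion_nonempty (n + 1))
    fun x hx y hy => ?_
  have hx' : x ∈ shellRegion Γ P v n := (hP.isClosed_shellRegion hΓ n).frontier_subset hx
  obtain ⟨γ, hγ, hxγ⟩ := Set.mem_iUnion₂.1 hx'
  have hsub : γ • shellRegion Γ P v 1 ⊆ shellRegion Γ P v (n + 1) := by
    rw [shellRegion_one]
    rintro _ ⟨z, hz, rfl⟩
    obtain ⟨τ, hτ, hzτ⟩ := Set.mem_iUnion₂.1 hz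
    refine Set.mem_iUnion₂.2 ⟨γ * τ, ?_, ?_⟩
    · rw [pow_succ]; exact Set.mul_mem_mul hγ hτ
    · rw [mul_smul]; exact Set.smul_mem_smul_set hzτ
  have hPsub : P ⊆ shellRegion Γ P v 1 := by
    rw [shellRegion_one]
    intro z hz
    exact Set.mem_iUnion₂.2 ⟨1, one_mem_neighborSet, by simpa using hz⟩
  have h0 : γ⁻¹ • x ∈ P := Set.mem_smul_set_iff_inv_smul_mem.1 hxγ
  have h1 : γ⁻¹ • y ∉ interior (shellRegion Γ P v 1) := by
    intro h
    have h2 : y ∈ interior (γ • shellRegion Γ P v 1) := by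
      rw [interior_smul]; exact Set.mem_smul_set_iff_inv_smul_mem.2 h
    exact hy.2 (interior_mono hsub h2)
  have hpre := isPreconnected_geodSegment (γ⁻¹ • x) (γ⁻¹ • y)
  obtain ⟨z, hz, hz'⟩ := inter_frontier_nonempty hpre (left_mem_geodSegment _ _)
    (right_mem_geodSegment _ _) h0 fun h => h1 (interior_mono hPsub h)
  obtain ⟨w, hw, hw'⟩ := inter_frontier_nonempty hpre (left_mem_geodSegment _ _)
    (right_mem_geodSegment _ _) (hPsub h0) h1
  calc crossingDist Γ P v 0 ≤ dist z w := setDist_le (by rwa [shellRegion_zero]) hw'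
    _ ≤ dist (γ⁻¹ • x) (γ⁻¹ • y) := dist_le_of_mem_geodSegment hz hw
    _ = dist x y := dist_smul _ _ _

/-- The boundary of `T (P)` consists of points of tiles without a common vertex with `P`. -/
lemma le_crossingDist_zero (hΓ : IsFuchsian Γ) (hP : IsFundamentalPolygon Γ P v) {m : ℝ}
    (hb : SideBounds m v) : m ≤ crossingDist Γ P v 0 := by
  refine le_setDist (hP.frontier_shellRegion_nonempty 0) (hP.frontier_shellRegion_nonempty 1)
    fun x hx y hy => ?_
  rw [shellRegion_zero] at hx
  have hxP : x ∈ P := hP.polygon.isClosed.frontier_subset hx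
  have hfar : IsClosed (⋃ γ ∈ (Γ : Set SL(2, ℝ)) \ neighborSet Γ P v, γ • P) :=
    hP.isClosed_biUnion_smul hΓ Set.sdiff_subset
  have hy' : y ∈ ⋃ γ ∈ (Γ : Set SL(2, ℝ)) \ neighborSet Γ P v, γ • P := by
    rw [shellRegion_one, frontier_eq_closure_inter_closure] at hy
    refine hfar.closure_subset_iff.2 ?_ hy.2
    intro z hz
    obtain ⟨γ, hγ, hzγ⟩ := hP.covers z
    exact Set.mem_iUnion₂.2 ⟨γ, ⟨hγ, fun h => hz (Set.mem_iUnion₂.2 ⟨γ, h, hzγ⟩)⟩, hzγ⟩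
  obtain ⟨σ, ⟨hσ, hσT⟩, hyσ⟩ := Set.mem_iUnion₂.1 hy'
  by_contra! hlt
  obtain ⟨p₀, hp⟩ := hP.polygon.interior_nonempty
  obtain ⟨V, ⟨k, hk⟩, ⟨l, hl⟩⟩ := (hP.tiling hΓ hp).exists_common_vertex
    (fun o => hb.smul (rep o)) (i := orbitPoint p₀ Γ.one_mem) (n := orbitPoint p₀ hσ)
    (show x ∈ rep _ • P by rwa [hP.rep_orbitPoint_smul_set hp, one_smul])
    (show y ∈ rep _ • P by rwa [hP.rep_orbitPoint_smul_set hp]) hlt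
  have hk' : V = rep (orbitPoint p₀ Γ.one_mem) • v k := hk
  have hl' : V = rep (orbitPoint p₀ hσ) • v l := hl
  rw [hP.rep_orbitPoint_smul hp] at hk' hl'
  rw [one_smul] at hk'
  exact hσT ⟨hσ, Or.inr (Or.inr ⟨k, l, by rw [← hl', hk']⟩)⟩

end IsFundamentalPolygon

end HypTess

theorem mainTheorem2 {N : ℕ} (Γ : Subgroup (Matrix.SpecialLinearGroup (Fin 2) ℝ))
    (P : Set UpperHalfPlane) (v : ZMod N → UpperHalfPlane)
    (hΓ : HypTess.IsFuchsian Γ) (hP : HypTess.IsFundamentalPolygon Γ P v) :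
    IsLeast (Set.range (HypTess.crossingDist Γ P v)) (HypTess.shellCrossingDist Γ P v) ∧
    HypTess.shellCrossingDist Γ P v =
      HypTess.setDist (frontier P) (frontier (⋃ γ ∈ HypTess.neighborSet Γ P v, γ • P)) ∧
    ∃ m : ℝ,
      IsLeast ({d | ∃ i j : ZMod N, i ≠ j ∧ ¬ HypTess.Adjacent i j ∧ d = HypTess.delta v i j} ∪
        {d | ∃ k : ZMod N, d = 2 * HypTess.epsilon v k}) m ∧
      m ≤ HypTess.shellCrossingDist Γ P v := by
  have hleast : IsLeast (Set.range (HypTess.crossingDist Γ P v)) (HypTess.crossingDist Γ P v 0) :=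
    ⟨⟨0, rfl⟩, by rintro _ ⟨n, rfl⟩; exact hP.crossingDist_zero_le hΓ n⟩
  have heq : HypTess.shellCrossingDist Γ P v = HypTess.crossingDist Γ P v 0 := hleast.csInf_eq
  refine ⟨heq ▸ hleast, ?_, ?_⟩
  · rw [heq, HypTess.crossingDist, HypTess.IsFundamentalPolygon.shellRegion_zero,
      HypTess.IsFundamentalPolygon.shellRegion_one]
  have := hP.polygon.neZero
  set S := {d | ∃ i j : ZMod N, i ≠ j ∧ ¬ HypTess.Adjacent i j ∧ d = HypTess.delta v i j} ∪
    {d | ∃ k : ZMod N, d = 2 * HypTess.epsilon v k}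
  have hfin : S.Finite := by
    refine Set.Finite.union ?_ ?_
    · refine (Set.finite_range fun ij : ZMod N × ZMod N => HypTess.delta v ij.1 ij.2).subset ?_
      rintro _ ⟨i, j, -, -, rfl⟩
      exact ⟨(i, j), rfl⟩
    · refine (Set.finite_range fun k : ZMod N => 2 * HypTess.epsilon v k).subset ?_
      rintro _ ⟨k, rfl⟩
      exact ⟨k, rfl⟩
  obtain ⟨m, hmS, hm⟩ := Set.exists_min_image S id hfin ⟨_, Or.inr ⟨0, rfl⟩⟩
  refine ⟨m, ⟨hmS, fun d hd => hm d hd⟩, ?_⟩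
  rw [heq]
  exact hP.le_crossingDist_zero hΓ (HypTess.sideBounds_of_le
    (fun i j hij hadj => hm _ (Or.inl ⟨i, j, hij, hadj, rfl⟩)) fun k => hm _ (Or.inr ⟨k, rfl⟩))
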